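/- Let $X=(\ell^2(\mathbb C))^4$ be the Hilbert space of vectors $\theta=(z,\zeta,p,q)$ with components in $\ell^2(\mathbb C)$, $\mathbb N=\{1,2,\dots\}$. Let $b=(b_k)_{k\ge1}$ and $(\omega_k)_{k\ge 1}$ be real sequences such that (A1) $b\in\ell^2(\mathbb R)$ and $b_k\ne0$ for all $k$; (A2) $\omega_1>0$ and there is $\omega_*>0$ with $\omega_{k+1}-\omega_k\ge\omega_*$ for all $k$; (A4) $\sum_{k\ge1}\sum_{j\ne k}\frac{b_j^2}{(\omega_j-\omega_k)^2}<\infty$. Put $\Omega=\mathrm{diag}(\omega_1,\omega_2,\dots)$ with its maximal domain $D(\Omega)$ in $\ell^2(\mathbb C)$, $b^*x=\sum_j b_jx_j$, and let $\mathcal A$ be the operator on $X$ with domain $D(\mathcal A)=D(\Omega)^4$ and $$\mathcal A=\begin{pmatrix}-i\Omega&0&\frac12bb^*&-\frac12bb^*\\0&i\Omega&-\frac12bb^*&\frac12bb^*\\I&0&-i\Omega&0\\0&I&0&i\Omega\end{pmatrix}.$$ For $\sigma\in\mathbb C\setminus\{\pm i\omega_1,\pm i\omega_2,\dots\}$ let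 $$\theta(\sigma)=\big((\sigma I+i\Omega)^{-1}b,\;-(\sigma I-i\Omega)^{-1}b,\;(\sigma I+i\Omega)^{-2}b,\;-(\sigma I-i\Omega)^{-2}b\big)\in X,$$ and let $$\lambda_k^0=\frac{|b_k|}{\sqrt{2+\frac{b_k^2}{4\omega_k^2}+2\sum_{j\neq k}\frac{b_j^2(\omega_k^2+\omega_j^2)}{(\omega_k^2-\omega_j^2)^2}}}.$$ (i) For all sufficiently large $k$ there is exactly one $\mu\in\mathbb C$ with $|\mu-\lambda_k^0|<\lambda_k^0/2$ such that $i\omega_k+\mu$ is an eigenvalue of $\mathcal A$. (ii) Let $(\nu_k)_{k\ge1}$ be any complex sequence such that the numbers $$\sigma_k^+=i\omega_k+\nu_k,\quad \sigma_k^-=i\omega_k-\overline{\nu_k},\quad \sigma_{-k}^+=-i\omega_k+\overline{\nu_k},\quad \sigma_{-k}^-=-i\omega_k-\nu_k\qquad(k\in\mathbb N)$$ are pairwise distinct eigenvalues of $\mathcal A$ and $\nu_k=\lambda_k^0+\varepsilon_k$ with $|\varepsilon_k|<\lambda_k^0/2$ for all sufficiently large $k$. Then $\theta_{\pm k}^{\pm}:=\theta(\sigma_{\pm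 k}^{\pm})$ are eigenvectors of $\mathcal A$ for the eigenvalues $\sigma_{\pm k}^{\pm}$ (the signs corresponding to each other), and the family of linear combinations $$\theta_k^z=\frac{\overline{\nu_k}^2\theta_{-k}^+-\nu_k^2\theta_{-k}^-}{2b_k\,\mathrm{Re}\,\nu_k},\quad \theta_k^\zeta=-\frac{\nu_k^2\theta_{k}^+-\overline{\nu_k}^2\theta_{k}^-}{2b_k\,\mathrm{Re}\,\nu_k},\quad \theta_k^p=\frac{\overline{\nu_k}^2\theta_{-k}^++\nu_k^2\theta_{-k}^-}{2b_k},\quad \theta_k^q=-\frac{\nu_k^2\theta_{k}^++\overline{\nu_k}^2\theta_{k}^-}{2b_k},\qquad k\in\mathbb N,$$ is a Riesz basis of $X$, i.e. the image of an orthonormal basis of $X$ under a bounded linear operator of $X$ onto itself with bounded inverse. -/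

import Mathlib

open Filter Topology

noncomputable section

/-- The real Hilbert space `ℓ²(ℝ)`. Sequences are indexed from `0`. -/
abbrev EllTwoReal : Type := lp (fun _ : ℕ => ℝ) 2

/-- The complex Hilbert space `ℓ²(ℂ)`. -/
abbrev EllTwoComplex : Type := lp (fun _ : ℕ => ℂ) 2

/-- The Hilbert space `X = (ℓ²(ℂ))⁴`; the components `0, 1, 2, 3` of a vector are
`z, ζ, p, q`. -/
abbrev StateSpace : Type := PiLp 2 (fun _ : Fin 4 => EllTwoComplex)

/-- The frequencies are positive and separated by a uniform gap:
`ω₁ > 0` and `ω_{k+1} - ω_k ≥ ω_* > 0` for all `k`. -/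
def GapCondition (ω : ℕ → ℝ) : Prop :=
  0 < ω 0 ∧ ∃ c : ℝ, 0 < c ∧ ∀ k, c ≤ ω (k + 1) - ω k

/-- `∑_k ∑_{j ≠ k} b_j² / (ω_j - ω_k)² < ∞`. -/
def DoubleSumCondition (ω b : ℕ → ℝ) : Prop :=
  Summable fun i : {i : ℕ × ℕ // i.2 ≠ i.1} =>
    b i.1.2 ^ 2 / (ω i.1.2 - ω i.1.1) ^ 2

/-- The real sequence `b`, regarded as a vector of `ℓ²(ℂ)`. -/
def complexify (b : EllTwoReal) : EllTwoComplex :=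
  ⟨fun k => ((b k : ℝ) : ℂ), by
    refine memℓp_gen ?_
    simpa using (lp.memℓp b).summable (by norm_num)⟩

/-- The unbounded diagonal operator `Ω = diag(ω₁, ω₂, …)` on `ℓ²(ℂ)` with its maximal domain
`{x ∈ ℓ²(ℂ) | (ω_k x_k)_k ∈ ℓ²(ℂ)}`. -/
def diagonalOp (ω : ℕ → ℝ) : EllTwoComplex →ₗ.[ℂ] EllTwoComplex where
  domain :=
    { carrier := {x | Memℓp (fun k => (ω k : ℂ) * x k) 2}
      zero_mem' := by
        have h : (fun k => (ω k : ℂ) * (0 : EllTwoComplex) k) = (0 : ℕ → ℂ) := by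
          ext k; simp
        simp only [Set.mem_ofPred_eq, h]
        exact zero_memℓp
      add_mem' := by
        intro x y hx hy
        have h : (fun k => (ω k : ℂ) * (x + y) k)
            = (fun k => (ω k : ℂ) * x k) + fun k => (ω k : ℂ) * y k := by
          ext k; simp [mul_add]
        simp only [Set.mem_ofPred_eq, h]
        exact Memℓp.add hx hy
      smul_mem' := by
        intro c x hx
        have h : (fun k => (ω k : ℂ) * (c • x) k)
            = c • fun k => (ω k : ℂ) * x k := by
          ext k; simp [mul_left_comm]
        simp only [Set.mem_ofPred_eq, h]
        exact Memℓp.const_smul hx c }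
  toFun :=
    { toFun := fun x => ⟨fun k => (ω k : ℂ) * (x : EllTwoComplex) k, x.2⟩
      map_add' := by
        intro x y
        ext k
        exact mul_add _ _ _
      map_smul' := by
        intro c x
        ext k
        exact mul_left_comm _ _ _ }

/-- The Hamiltonian operator with domain `D(Ω)⁴`, in block form

`𝒜 = [ -iΩ, 0, ½bb*, -½bb* ; 0, iΩ, -½bb*, ½bb* ; I, 0, -iΩ, 0 ; 0, I, 0, iΩ ]`,

where `b* p = ∑ b_j p_j` (the inner product is linear in its second argument). -/
def hamiltonianOp (ω : ℕ → ℝ) (b : EllTwoReal) : StateSpace →ₗ.[ℂ] StateSpace where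
  domain :=
    { carrier := {θ | ∀ i, θ i ∈ (diagonalOp ω).domain}
      zero_mem' := fun _ => (diagonalOp ω).domain.zero_mem
      add_mem' := fun hx hy i => (diagonalOp ω).domain.add_mem (hx i) (hy i)
      smul_mem' := fun c _ hx i => (diagonalOp ω).domain.smul_mem c (hx i) }
  toFun :=
    { toFun := fun θ =>
        WithLp.toLp 2
          ![ -Complex.I • diagonalOp ω ⟨θ.1 0, θ.2 0⟩
                + ((1 / 2 : ℂ) * inner ℂ (complexify b) (θ.1 2)) • complexify b
                - ((1 / 2 : ℂ) * inner ℂ (complexify b) (θ.1 3)) • complexify b,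
             Complex.I • diagonalOp ω ⟨θ.1 1, θ.2 1⟩
                - ((1 / 2 : ℂ) * inner ℂ (complexify b) (θ.1 2)) • complexify b
                + ((1 / 2 : ℂ) * inner ℂ (complexify b) (θ.1 3)) • complexify b,
             θ.1 0 - Complex.I • diagonalOp ω ⟨θ.1 2, θ.2 2⟩,
             θ.1 1 + Complex.I • diagonalOp ω ⟨θ.1 3, θ.2 3⟩ ]
      map_add' := by
        intro x y
        have h : ∀ i (hi : x.1 i + y.1 i ∈ (diagonalOp ω).domain),
            diagonalOp ω ⟨x.1 i + y.1 i, hi⟩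
              = diagonalOp ω ⟨x.1 i, x.2 i⟩ + diagonalOp ω ⟨y.1 i, y.2 i⟩ := fun i _ =>
          (diagonalOp ω).toFun.map_add ⟨x.1 i, x.2 i⟩ ⟨y.1 i, y.2 i⟩
        ext i : 1
        fin_cases i <;>
          simp [h, smul_add, mul_add, add_smul] <;> module
      map_smul' := by
        intro c x
        have h : ∀ i (hi : c • x.1 i ∈ (diagonalOp ω).domain),
            diagonalOp ω ⟨c • x.1 i, hi⟩ = c • diagonalOp ω ⟨x.1 i, x.2 i⟩ := fun i _ =>
          (diagonalOp ω).toFun.map_smul c ⟨x.1 i, x.2 i⟩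
        ext i : 1
        fin_cases i <;> simp [h] <;> module }

/-- `x` is an eigenvector of the unbounded operator `T` for the eigenvalue `σ`. -/
def IsEigenvectorOf {E : Type*} [AddCommGroup E] [Module ℂ E] (T : E →ₗ.[ℂ] E) (σ : ℂ)
    (x : E) : Prop :=
  x ≠ 0 ∧ ∃ hx : x ∈ T.domain, T ⟨x, hx⟩ = σ • x

/-- `σ` belongs to the point spectrum of the unbounded operator `T`. -/
def IsEigenvalueOf {E : Type*} [AddCommGroup E] [Module ℂ E] (T : E →ₗ.[ℂ] E) (σ : ℂ) :
    Prop :=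
  ∃ x, IsEigenvectorOf T σ x

/-- `λ⁰_k = |b_k| / √(2 + b_k²/(4ω_k²) + 2 ∑_{j ≠ k} b_j² (ω_k² + ω_j²)/(ω_k² - ω_j²)²)`. -/
def lambdaZero (ω b : ℕ → ℝ) (k : ℕ) : ℝ :=
  |b k| / √(2 + b k ^ 2 / (4 * ω k ^ 2)
    + 2 * ∑' j : {j : ℕ // j ≠ k},
        b j ^ 2 * (ω k ^ 2 + ω j ^ 2) / (ω k ^ 2 - ω j ^ 2) ^ 2)

/-- `σ_k⁺ = iω_k + ν_k`. -/
def sigmaUpPlus (ω : ℕ → ℝ) (ν : ℕ → ℂ) (k : ℕ) : ℂ :=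
  Complex.I * ω k + ν k

/-- `σ_k⁻ = iω_k - conj ν_k`. -/
def sigmaUpMinus (ω : ℕ → ℝ) (ν : ℕ → ℂ) (k : ℕ) : ℂ :=
  Complex.I * ω k - (starRingEnd ℂ) (ν k)

/-- `σ_{-k}⁺ = -iω_k + conj ν_k`. -/
def sigmaDownPlus (ω : ℕ → ℝ) (ν : ℕ → ℂ) (k : ℕ) : ℂ :=
  -(Complex.I * ω k) + (starRingEnd ℂ) (ν k)

/-- `σ_{-k}⁻ = -iω_k - ν_k`. -/
def sigmaDownMinus (ω : ℕ → ℝ) (ν : ℕ → ℂ) (k : ℕ) : ℂ :=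
  -(Complex.I * ω k) - ν k

/-- The four families `σ_k⁺, σ_k⁻, σ_{-k}⁺, σ_{-k}⁻` as one family. -/
def sigmaFamily (ω : ℕ → ℝ) (ν : ℕ → ℂ) (i : ℕ × Fin 4) : ℂ :=
  ![sigmaUpPlus ω ν i.1, sigmaUpMinus ω ν i.1, sigmaDownPlus ω ν i.1,
    sigmaDownMinus ω ν i.1] i.2

/-- The sequence `ν` labels eigenvalues of `𝒜`: the numbers
`iω_k + ν_k, iω_k - conj ν_k, -iω_k + conj ν_k, -iω_k - ν_k` are eigenvalues, listed without
repetition, and `ν_k = λ⁰_k + ε_k` with `|ε_k| < λ⁰_k / 2` for all large `k`. -/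
structure IsSpectralLabelling (ω : ℕ → ℝ) (b : EllTwoReal) (ν : ℕ → ℂ) : Prop where
  isEigenvalue : ∀ i, IsEigenvalueOf (hamiltonianOp ω b) (sigmaFamily ω ν i)
  injective : Function.Injective (sigmaFamily ω ν)
  asymptotics : ∀ᶠ k in atTop, ‖ν k - (lambdaZero ω b k : ℂ)‖ < lambdaZero ω b k / 2

theorem GapCondition.tendsto_atTop {ω : ℕ → ℝ} (hω : GapCondition ω) :
    Tendsto ω atTop atTop := by
  obtain ⟨-, c, hc, h⟩ := hω
  have hlin : ∀ k : ℕ, ω 0 + k * c ≤ ω k := by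
    intro k
    induction k with
    | zero => simp
    | succ k ih =>
      have := h k
      push_cast
      linarith
  refine tendsto_atTop_mono hlin ?_
  exact tendsto_atTop_add_const_left _ _
    (tendsto_natCast_atTop_atTop.atTop_mul_const hc)

theorem GapCondition.bounded_inv {ω : ℕ → ℝ} (hω : GapCondition ω) (σ s : ℂ)
    (hs : ‖s‖ = 1) : ∃ C : ℝ, ∀ k, ‖(σ + s * (ω k : ℂ))⁻¹‖ ≤ C := by
  have h1 : Tendsto (fun k => ‖s * (ω k : ℂ)‖) atTop atTop := by
    refine (tendsto_abs_atTop_atTop.comp hω.tendsto_atTop).congr fun k => ?_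
    simp [hs]
  have h2 : Tendsto (fun k => ‖σ + s * (ω k : ℂ)‖) atTop atTop := by
    refine tendsto_atTop_mono (fun k => ?_) (tendsto_atTop_add_const_right _ (-‖σ‖) h1)
    have := norm_sub_le (σ + s * (ω k : ℂ)) σ
    rw [add_sub_cancel_left] at this
    linarith
  have h3 : Tendsto (fun k => ‖(σ + s * (ω k : ℂ))⁻¹‖) atTop (𝓝 0) := by
    refine h2.inv_tendsto_atTop.congr fun k => ?_
    simp
  obtain ⟨C, hC⟩ := h3.bddAbove_range
  exact ⟨C, fun k => hC ⟨k, rfl⟩⟩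

theorem GapCondition.memℓp_inv_pow {ω : ℕ → ℝ} (hω : GapCondition ω) (b : EllTwoReal)
    (σ s c : ℂ) (hs : ‖s‖ = 1) (n : ℕ) :
    Memℓp (fun k => c * (((σ + s * (ω k : ℂ))⁻¹) ^ n * ((b k : ℝ) : ℂ))) 2 := by
  obtain ⟨C, hC⟩ := hω.bounded_inv σ s hs
  have hb : Summable fun k => ‖(complexify b) k‖ ^ (2 : ℝ) := by
    simpa using (lp.memℓp (complexify b)).summable (by norm_num)
  refine memℓp_gen ?_
  refine Summable.of_nonneg_of_le (fun k => by positivity) (fun k => ?_)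
    (hb.mul_left ((‖c‖ * C ^ n) ^ (2 : ℝ)))
  have hC0 : 0 ≤ C := (norm_nonneg _).trans (hC k)
  rw [← Real.mul_rpow (by positivity) (norm_nonneg _)]
  refine Real.rpow_le_rpow (norm_nonneg _) ?_ (by norm_num)
  rw [norm_mul, norm_mul, norm_pow, mul_assoc]
  change ‖c‖ * (_ * ‖(complexify b) k‖) ≤ _
  gcongr
  exact hC k

/-- For `‖s‖ = 1`, the vector `c (σ I + s Ω)^{-n} b` of `ℓ²(ℂ)`, with coordinates
`c (σ + s ω_k)^{-n} b_k`. -/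
def resolventVec (ω : ℕ → ℝ) (b : EllTwoReal) (hω : GapCondition ω) (σ s c : ℂ)
    (hs : ‖s‖ = 1) (n : ℕ) : EllTwoComplex :=
  ⟨fun k => c * (((σ + s * (ω k : ℂ))⁻¹) ^ n * ((b k : ℝ) : ℂ)),
    hω.memℓp_inv_pow b σ s c hs n⟩

/-- The vector `θ(σ) = ((σI+iΩ)⁻¹b, -(σI-iΩ)⁻¹b, (σI+iΩ)⁻²b, -(σI-iΩ)⁻²b)` of `X`, meaningful
for `σ ∉ {±iω₁, ±iω₂, …}`. -/
def thetaVec (ω : ℕ → ℝ) (b : EllTwoReal) (hω : GapCondition ω) (σ : ℂ) : StateSpace :=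
  WithLp.toLp 2
    ![resolventVec ω b hω σ Complex.I 1 (by simp) 1,
      resolventVec ω b hω σ (-Complex.I) (-1) (by simp) 1,
      resolventVec ω b hω σ Complex.I 1 (by simp) 2,
      resolventVec ω b hω σ (-Complex.I) (-1) (by simp) 2]

/-- `θ_k^z = (conj(ν_k)² θ_{-k}⁺ - ν_k² θ_{-k}⁻) / (2 b_k Re ν_k)`. -/
def thetaZ (ω : ℕ → ℝ) (b : EllTwoReal) (hω : GapCondition ω) (ν : ℕ → ℂ) (k : ℕ) :
    StateSpace :=
  (1 / (2 * (b k : ℂ) * ((ν k).re : ℂ))) •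
    ((starRingEnd ℂ) (ν k) ^ 2 • thetaVec ω b hω (sigmaDownPlus ω ν k)
      - ν k ^ 2 • thetaVec ω b hω (sigmaDownMinus ω ν k))

/-- `θ_k^ζ = -(ν_k² θ_k⁺ - conj(ν_k)² θ_k⁻) / (2 b_k Re ν_k)`. -/
def thetaZeta (ω : ℕ → ℝ) (b : EllTwoReal) (hω : GapCondition ω) (ν : ℕ → ℂ) (k : ℕ) :
    StateSpace :=
  -(1 / (2 * (b k : ℂ) * ((ν k).re : ℂ))) •
    (ν k ^ 2 • thetaVec ω b hω (sigmaUpPlus ω ν k)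
      - (starRingEnd ℂ) (ν k) ^ 2 • thetaVec ω b hω (sigmaUpMinus ω ν k))

/-- `θ_k^p = (conj(ν_k)² θ_{-k}⁺ + ν_k² θ_{-k}⁻) / (2 b_k)`. -/
def thetaP (ω : ℕ → ℝ) (b : EllTwoReal) (hω : GapCondition ω) (ν : ℕ → ℂ) (k : ℕ) :
    StateSpace :=
  (1 / (2 * (b k : ℂ))) •
    ((starRingEnd ℂ) (ν k) ^ 2 • thetaVec ω b hω (sigmaDownPlus ω ν k)
      + ν k ^ 2 • thetaVec ω b hω (sigmaDownMinus ω ν k))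

/-- `θ_k^q = -(ν_k² θ_k⁺ + conj(ν_k)² θ_k⁻) / (2 b_k)`. -/
def thetaQ (ω : ℕ → ℝ) (b : EllTwoReal) (hω : GapCondition ω) (ν : ℕ → ℂ) (k : ℕ) :
    StateSpace :=
  -(1 / (2 * (b k : ℂ))) •
    (ν k ^ 2 • thetaVec ω b hω (sigmaUpPlus ω ν k)
      + (starRingEnd ℂ) (ν k) ^ 2 • thetaVec ω b hω (sigmaUpMinus ω ν k))

/-- The family `{θ_k^z, θ_k^ζ, θ_k^p, θ_k^q}_k`. -/
def thetaFamily (ω : ℕ → ℝ) (b : EllTwoReal) (hω : GapCondition ω) (ν : ℕ → ℂ)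
    (i : ℕ × Fin 4) : StateSpace :=
  ![thetaZ ω b hω ν i.1, thetaZeta ω b hω ν i.1, thetaP ω b hω ν i.1,
    thetaQ ω b hω ν i.1] i.2

/-- A Riesz basis of a Hilbert space: the image of an orthonormal (Hilbert) basis under a
bounded operator with bounded inverse. -/
def IsRieszBasis {ι E : Type*} [NormedAddCommGroup E] [InnerProductSpace ℂ E] (v : ι → E) :
    Prop :=
  ∃ (e : HilbertBasis ι ℂ E) (T : E ≃L[ℂ] E), ∀ i, v i = T (e i)

end

/-! The coordinates interact only through the scalar `feedback b x` $= \frac12 b^*(p-q)$, so an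
eigenvector for $\sigma$ must be `feedback b x` times $\theta(\sigma)$. Away from the points $\pm
i\omega_k$, which are never eigenvalues, $\sigma$ is therefore an eigenvalue exactly when
$f(\theta(\sigma))=1$, where $f$ is the feedback (`IsEigenvalueOf.ne_and_feedback`,
`isEigenvectorOf_thetaVec`).

For (i), put $\sigma=i\omega_k+\mu$ and split off the singular term:
$f(\theta(\sigma))=b_k^2/(2\mu^2)+h_k(\mu)$. With $G_k=1-h_k(0)\ge1$ one has
$\lambda_k^0=|b_k|/\sqrt{2G_k}$, so the equation reads
$(1-h_k(\mu))\mu^2=(1-h_k(0))(\lambda_k^0)^2$. The Lipschitz constant of $h_k$ near $0$ is a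
multiple of the $k$-th row sum of `gapWeight` squared, which tends to $0$ by (A1) and (A4), and a
contraction on the disc around $\lambda_k^0$ gives the unique root
(`existsUnique_sq_mul_eq_of_lipschitz`).

For (ii), the two eigenvectors belonging to the same point $\pm i\omega_k$ become parallel after
scaling, so one passes to sums and divided differences $v_i$. These are quadratically close to the
standard basis $e_i$ (`IsSpectralLabelling.summable_norm_sub_sq`), so $Te_i=v_i$ defines $T=1+K$
with $K$ compact, and by the Fredholm alternative only injectivity is at stake. A bounded operator
$R$, namely the formula for $(\mathcal A-s)^{-1}$, has all $\theta(\sigma)$ as eigenvectors with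
distinct eigenvalues. On the basis side it is matched by an operator $D$, block diagonal with
$2\times2$ blocks, with $TD=RT$. The finite-dimensional space $\ker T$ is invariant under $D$, so if
nonzero it contains an eigenvector of $D$; distinctness of the eigenvalues forces $T$ to send it to
a nonzero multiple of a single $\theta(\sigma)$, a contradiction
(`isRieszBasis_of_eigenvector_pairs`). -/

/-! ### Compact perturbations of the identity and Hilbert bases. -/

noncomputable section AbstractRieszBasis

variable {ι H : Type*} [NormedAddCommGroup H] [InnerProductSpace ℂ H]

/-- Cauchy–Schwarz and Bessel. This is the bound of the operator norm by the Hilbert–Schmidt norm,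
needed for finite sections. -/
theorem HilbertBasis.norm_sum_inner_smul_sq_le (e : HilbertBasis ι ℂ H) (v : ι → H)
    (s : Finset ι) (x : H) :
    ‖∑ i ∈ s, inner ℂ (e i) x • v i‖ ^ 2 ≤ ‖x‖ ^ 2 * ∑ i ∈ s, ‖v i‖ ^ 2 := by
  have h1 : ‖∑ i ∈ s, inner ℂ (e i) x • v i‖ ≤ ∑ i ∈ s, ‖inner ℂ (e i) x‖ * ‖v i‖ :=
    (norm_sum_le _ _).trans_eq (by simp only [norm_smul])
  calc ‖∑ i ∈ s, inner ℂ (e i) x • v i‖ ^ 2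
      ≤ (∑ i ∈ s, ‖inner ℂ (e i) x‖ * ‖v i‖) ^ 2 := by gcongr
    _ ≤ (∑ i ∈ s, ‖inner ℂ (e i) x‖ ^ 2) * ∑ i ∈ s, ‖v i‖ ^ 2 :=
        Finset.sum_mul_sq_le_sq_mul_sq _ _ _
    _ ≤ ‖x‖ ^ 2 * ∑ i ∈ s, ‖v i‖ ^ 2 := by
        gcongr
        exact e.orthonormal.sum_inner_products_le (x := x)

/-- A square-summable family is the image of a Hilbert basis under a compact operator. -/
theorem HilbertBasis.exists_isCompactOperator [CompleteSpace H] (e : HilbertBasis ι ℂ H) (v : ι → H)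
    (hv : Summable fun i => ‖v i‖ ^ 2) :
    ∃ K : H →L[ℂ] H, IsCompactOperator K ∧ ∀ i, K (e i) = v i := by
  classical
  let F : ι → H →L[ℂ] H := fun i => (innerSL ℂ (e i)).smulRight (v i)
  have hF : ∀ (s : Finset ι) (x : H), (∑ i ∈ s, F i) x = ∑ i ∈ s, inner ℂ (e i) x • v i := by
    intro s x
    simp [F]
  have hnorm : ∀ s : Finset ι, ‖∑ i ∈ s, F i‖ ≤ √(∑ i ∈ s, ‖v i‖ ^ 2) := by
    intro s
    refine ContinuousLinearMap.opNorm_le_bound _ (Real.sqrt_nonneg _) fun x => ?_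
    rw [hF]
    refine le_of_sq_le_sq ?_ (by positivity)
    rw [mul_pow, Real.sq_sqrt (Finset.sum_nonneg fun _ _ => by positivity), mul_comm]
    exact e.norm_sum_inner_smul_sq_le v s x
  -- By the Hilbert–Schmidt bound, finite blocks of rank-one operators outside a large finite set
  -- are small in operator norm.
  have hsum : Summable F := by
    rw [summable_iff_vanishing_norm]
    intro ε hε
    obtain ⟨s, hs⟩ := summable_iff_vanishing_norm.1 hv (ε ^ 2) (by positivity)
    refine ⟨s, fun t ht => (hnorm t).trans_lt ?_⟩
    rw [Real.sqrt_lt' hε]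
    exact (le_abs_self _).trans_lt (hs t ht)
  refine ⟨∑' i, F i, ?_, fun i => ?_⟩
  · refine isCompactOperator_of_tendsto (l := atTop) hsum.hasSum (Eventually.of_forall fun s => ?_)
    refine (compactOperator (RingHom.id ℂ) H H).sum_mem fun i _ => ?_
    have h : IsCompactOperator (ContinuousLinearMap.toSpanSingleton ℂ (v i)) :=
      isCompactOperator_of_locallyCompactSpace_rng _
    exact h.comp_clm (innerSL ℂ (e i))
  · have h := hsum.hasSum.mapL (ContinuousLinearMap.apply ℂ H (e i))
    refine h.unique ?_
    convert hasSum_ite_eq i (v i) using 2 with j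
    have := (orthonormal_iff_ite.1 e.orthonormal) j i
    simp only [F, ContinuousLinearMap.apply_apply, ContinuousLinearMap.smulRight_apply,
      innerSL_apply_apply, this, ite_smul, one_smul, zero_smul]
    split_ifs with hji
    · rw [hji]
    · rfl

theorem HilbertBasis.ext_continuousLinearMap {F : Type*} [NormedAddCommGroup F] [NormedSpace ℂ F]
    (e : HilbertBasis ι ℂ H) {f g : H →L[ℂ] F} (h : ∀ i, f (e i) = g (e i)) : f = g := by
  refine ContinuousLinearMap.ext_on (s := Set.range e) ?_ ?_
  · rw [dense_iff_closure_eq, ← Submodule.topologicalClosure_coe, e.dense_span]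
    rfl
  · rintro _ ⟨i, rfl⟩
    exact h i

/-- On the kernel $-K$ acts as the identity, so the identity of a closed subspace is compact and
Riesz's theorem applies. -/
theorem IsCompactOperator.finiteDimensional_ker_one_add [CompleteSpace H] {K : H →L[ℂ] H}
    (hK : IsCompactOperator K) : FiniteDimensional ℂ (1 + K).ker := by
  set N := (1 + K).ker with hN
  have hmem : ∀ x ∈ N, K x = -x := by
    intro x hx
    have : x + K x = 0 := by simpa [hN] using hx
    exact (neg_eq_of_add_eq_zero_right this).symm
  have hV : ∀ x ∈ N, (-K : H →L[ℂ] H) x ∈ N := by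
    intro x hx
    simpa [hmem x hx] using hx
  have hcl : IsClosed (N : Set H) := (1 + K).isClosed_ker
  have h := IsCompactOperator.restrict (f := ((-K : H →L[ℂ] H) : H →ₗ[ℂ] H)) hK.neg hV hcl
  refine FiniteDimensional.of_isCompactOperator_id (𝕜 := ℂ) ?_
  have h2 : (((-K : H →L[ℂ] H) : H →ₗ[ℂ] H).restrict hV : N → N) = id :=
    funext fun x => Subtype.ext (by simp [hmem x x.2])
  exact h2 ▸ h

theorem IsCompactOperator.isUnit_one_add [CompleteSpace H] {K : H →L[ℂ] H}
    (hK : IsCompactOperator K)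
    (hinj : ∀ x, (1 + K) x = 0 → x = 0) : IsUnit (1 + K) := by
  rcases hK.hasEigenvalue_or_mem_resolventSet (μ := -1) (by simp) with h | h
  · obtain ⟨x, hx⟩ := h.exists_hasEigenvector
    refine absurd (hinj x ?_) hx.2
    have := hx.apply_eq_smul
    simp only [ContinuousLinearMap.coe_coe] at this
    simp [this]
  · rw [spectrum.mem_resolventSet_iff] at h
    have := h.neg
    convert this using 1
    simp [add_comm]

/-- The intertwining makes $\ker T$ invariant under `D`, so a nonzero kernel contains an eigenvector
$x$ of `D`. The `Y i` are left eigenvectors with distinct eigenvalues, so at most one of them is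
nonzero at $x$; as they separate points, exactly one is, and `h1` excludes this. -/
theorem ContinuousLinearMap.ker_eq_bot_of_intertwining {κ : Type*} {T R D : H →L[ℂ] H}
    [FiniteDimensional ℂ T.ker] (hTD : T ∘L D = R ∘L T) {Y : κ → H →L[ℂ] ℂ} {r : κ → ℂ}
    (hr : Function.Injective r) (hY : ∀ i x, Y i (D x) = r i * Y i x)
    (h0 : ∀ x, (∀ i, Y i x = 0) → x = 0)
    (h1 : ∀ x i, Y i x ≠ 0 → (∀ j, j ≠ i → Y j x = 0) → T x ≠ 0) : T.ker = ⊥ := by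
  by_contra hne
  have : Nontrivial T.ker := Submodule.nontrivial_iff_ne_bot.2 hne
  have hD : ∀ x ∈ T.ker, (D : H →ₗ[ℂ] H) x ∈ T.ker := by
    intro x hx
    have h2 : T (D x) = R (T x) := DFunLike.congr_fun hTD x
    have h3 : T x = 0 := hx
    change T (D x) = 0
    rw [h2, h3, map_zero]
  obtain ⟨c, hc⟩ := Module.End.exists_eigenvalue ((D : H →ₗ[ℂ] H).restrict hD)
  obtain ⟨x, hx⟩ := hc.exists_hasEigenvector
  have hDx : D x = c • (x : H) := congrArg Subtype.val hx.apply_eq_smul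
  have hx0 : (x : H) ≠ 0 := fun h => hx.2 (Subtype.ext h)
  have hYx : ∀ i, (r i - c) * Y i x = 0 := by
    intro i
    have := hY i x
    rw [hDx, map_smul, smul_eq_mul] at this
    linear_combination -this
  obtain ⟨i, hi⟩ : ∃ i, Y i x ≠ 0 := by
    by_contra! h
    exact hx0 (h0 x h)
  refine h1 x i hi (fun j hj => ?_) x.2
  have hrc : r i = c := by
    have := (mul_eq_zero.1 (hYx i)).resolve_right hi
    exact sub_eq_zero.1 this
  refine (mul_eq_zero.1 (hYx j)).resolve_left fun h => hj (hr ?_)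
  rw [hrc, sub_eq_zero.1 h]

/-- Reindexing of a Hilbert basis along an equivalence. -/
def HilbertBasis.reindexEquiv [CompleteSpace H] {ι' : Type*} (e : HilbertBasis ι ℂ H) (φ : ι' ≃ ι) :
    HilbertBasis ι' ℂ H :=
  HilbertBasis.mk (v := e ∘ φ) (e.orthonormal.comp _ φ.injective) (by
    rw [φ.surjective.range_comp, e.dense_span])

@[simp] theorem HilbertBasis.reindexEquiv_apply [CompleteSpace H] {ι' : Type*}
    (e : HilbertBasis ι ℂ H) (φ : ι' ≃ ι) (i : ι') : e.reindexEquiv φ i = e (φ i) := by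
  simp [HilbertBasis.reindexEquiv]

theorem IsRieszBasis.of_comp_equiv [CompleteSpace H] {ι' : Type*} {v : ι → H} (φ : ι' ≃ ι)
    (h : IsRieszBasis (v ∘ φ)) : IsRieszBasis v := by
  obtain ⟨e, T, h⟩ := h
  refine ⟨e.reindexEquiv φ.symm, T, fun i => ?_⟩
  simpa using h (φ.symm i)

end AbstractRieszBasis

/-! ### Riesz bases built from pairs of nearly parallel eigenvectors. -/

noncomputable section EigenvectorPairs

theorem summable_prod_of_finite {κ τ : Type*} [Finite τ] {f : κ × τ → ℝ} (hf : ∀ i, 0 ≤ f i)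
    (h : ∀ j, Summable fun k => f (k, j)) : Summable f := by
  rw [← (Equiv.prodComm τ κ).summable_iff,
    summable_prod_of_nonneg (f := f ∘ Equiv.prodComm τ κ) fun i => hf _]
  exact ⟨h, Summable.of_finite⟩

theorem summable_norm_add_sq {κ E : Type*} [NormedAddCommGroup E] {f g : κ → E}
    (hf : Summable fun k => ‖f k‖ ^ 2) (hg : Summable fun k => ‖g k‖ ^ 2) :
    Summable fun k => ‖f k + g k‖ ^ 2 := by
  refine Summable.of_nonneg_of_le (fun _ => by positivity) (fun k => ?_)
    ((hf.mul_left 2).add (hg.mul_left 2))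
  have := norm_add_le (f k) (g k)
  nlinarith [norm_nonneg (f k + g k), sq_nonneg (‖f k‖ - ‖g k‖)]

variable {κ H : Type*} [NormedAddCommGroup H] [InnerProductSpace ℂ H]

theorem HilbertBasis.eq_zero_of_forall_inner {ι : Type*} (e : HilbertBasis ι ℂ H) {x : H}
    (h : ∀ i, inner ℂ (e i) x = 0) : x = 0 := by
  refine e.repr.injective (lp.ext (funext fun i => ?_))
  simp [e.repr_apply_apply, h]

/-- A family that is quadratically close to a Hilbert basis and is built from pairs of
eigenvectors of a bounded operator with pairwise distinct eigenvalues is a Riesz basis. -/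
theorem isRieszBasis_of_eigenvector_pairs [CompleteSpace H] (e : HilbertBasis (κ × Fin 2) ℂ H)
    {w v : κ × Fin 2 → H} {R : H →L[ℂ] H} {r : κ × Fin 2 → ℂ} {ρ : κ → ℂ}
    (hw : ∀ i, w i ≠ 0) (hR : ∀ i, R (w i) = r i • w i) (hr : Function.Injective r)
    (hρ : ∀ k, ρ k ≠ 0) (hv0 : ∀ k, v (k, 0) = (ρ k)⁻¹ • (w (k, 0) - w (k, 1)))
    (hv1 : ∀ k, v (k, 1) = w (k, 0) + w (k, 1)) (hsum : Summable fun i => ‖v i - e i‖ ^ 2)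
    (hα : Summable fun k => ‖(r (k, 0) + r (k, 1)) / 2‖ ^ 2)
    (hβ : Summable fun k => ‖(r (k, 0) - r (k, 1)) / 2 * (ρ k)⁻¹‖ ^ 2)
    (hγ : Summable fun k => ‖(r (k, 0) - r (k, 1)) / 2 * ρ k‖ ^ 2) : IsRieszBasis v := by
  classical
  obtain ⟨K, hK, hKe⟩ := e.exists_isCompactOperator _ hsum
  set T : H →L[ℂ] H := 1 + K with hT
  have hTe : ∀ i, T (e i) = v i := fun i => by simp [hT, hKe]
  have he : ∀ i, ‖e i‖ = 1 := e.orthonormal.1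
  -- The columns of the block of `D`: the operator `R` on the span of $w_{k,0},w_{k,1}$, written in
  -- terms of $(w_{k,0}-w_{k,1})/\rho_k$ and $w_{k,0}+w_{k,1}$. The three summability hypotheses are
  -- those of its entries.
  let d : κ × Fin 2 → H := fun i =>
    ![((r (i.1, 0) + r (i.1, 1)) / 2) • e (i.1, 0)
        + ((r (i.1, 0) - r (i.1, 1)) / 2 * (ρ i.1)⁻¹) • e (i.1, 1),
      ((r (i.1, 0) + r (i.1, 1)) / 2) • e (i.1, 1)
        + ((r (i.1, 0) - r (i.1, 1)) / 2 * ρ i.1) • e (i.1, 0)] i.2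
  have hd : Summable fun i => ‖d i‖ ^ 2 := by
    refine summable_prod_of_finite (fun _ => by positivity) fun j => ?_
    fin_cases j
    · exact summable_norm_add_sq (by simpa only [norm_smul, he, mul_one] using hα)
        (by simpa only [norm_smul, he, mul_one] using hβ)
    · exact summable_norm_add_sq (by simpa only [norm_smul, he, mul_one] using hα)
        (by simpa only [norm_smul, he, mul_one] using hγ)
  obtain ⟨D, -, hDe⟩ := e.exists_isCompactOperator d hd
  have hTD : T ∘L D = R ∘L T := by
    refine e.ext_continuousLinearMap ?_
    rintro ⟨k, j⟩
    have hk := hρ k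
    simp only [ContinuousLinearMap.comp_apply, hDe, hTe]
    fin_cases j
    · simp only [d, Fin.zero_eta, Matrix.cons_val_zero, map_add, map_smul, hTe, hv0, hv1,
        map_sub, hR]
      match_scalars <;> field_simp <;> ring
    · simp only [d, Fin.mk_one, Matrix.cons_val_one, Matrix.cons_val_fin_one, map_add, map_smul,
        hTe, hv0, hv1, hR]
      match_scalars <;> field_simp <;> ring
  -- Up to the factors $\pm\rho_k$, these are the coefficients of $w_{k,0}$ and $w_{k,1}$ in the
  -- $k$-th block of $Tx$; hence they diagonalize `D` from the left.
  let Y : κ × Fin 2 → H →L[ℂ] ℂ := fun i =>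
    ![innerSL ℂ (e (i.1, 0)) + ρ i.1 • innerSL ℂ (e (i.1, 1)),
      innerSL ℂ (e (i.1, 0)) - ρ i.1 • innerSL ℂ (e (i.1, 1))] i.2
  have hY0 : ∀ k x, Y (k, 0) x = inner ℂ (e (k, 0)) x + ρ k * inner ℂ (e (k, 1)) x :=
    fun k x => by simp [Y]
  have hY1 : ∀ k x, Y (k, 1) x = inner ℂ (e (k, 0)) x - ρ k * inner ℂ (e (k, 1)) x :=
    fun k x => by simp [Y]
  have hin := orthonormal_iff_ite.1 e.orthonormal
  have hYD : ∀ i x, Y i (D x) = r i * Y i x := by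
    intro i
    have : Y i ∘L D = r i • Y i := by
      refine e.ext_continuousLinearMap ?_
      rintro ⟨k', j'⟩
      obtain ⟨k, j⟩ := i
      have hk := hρ k
      simp only [ContinuousLinearMap.comp_apply, hDe, smul_apply, smul_eq_mul]
      by_cases hkk : k = k'
      · subst hkk
        fin_cases j <;> fin_cases j' <;>
          simp [d, hY0, hY1, hin, he] <;> field_simp <;> ring
      · fin_cases j <;> fin_cases j' <;>
          simp [d, hY0, hY1, hin, hkk]
    exact fun x => DFunLike.congr_fun this x
  have hY_zero : ∀ k x, Y (k, 0) x = 0 → Y (k, 1) x = 0 → ∀ j, inner ℂ (e (k, j)) x = 0 := by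
    intro k x h0 h1
    rw [hY0] at h0
    rw [hY1] at h1
    refine Fin.forall_fin_two.2 ⟨?_, ?_⟩
    · exact mul_left_cancel₀ two_ne_zero (by linear_combination h0 + h1)
    · exact mul_left_cancel₀ (mul_ne_zero two_ne_zero (hρ k)) (by linear_combination h0 - h1)
  have hTx : ∀ x k, (∀ k', k' ≠ k → ∀ j, Y (k', j) x = 0) →
      T x = (ρ k)⁻¹ • (Y (k, 0) x • w (k, 0) - Y (k, 1) x • w (k, 1)) := by
    intro x k h
    have hx : x = inner ℂ (e (k, 0)) x • e (k, 0) + inner ℂ (e (k, 1)) x • e (k, 1) := by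
      rw [← sub_eq_zero]
      refine e.eq_zero_of_forall_inner ?_
      rintro ⟨k', j⟩
      by_cases hkk : k' = k
      · subst hkk
        fin_cases j <;> simp [hin, he]
      · have := hY_zero k' x (h k' hkk 0) (h k' hkk 1) j
        simp [hin, this, hkk]
    have hk := hρ k
    conv_lhs => rw [hx]
    simp only [map_add, map_smul, hTe, hv0, hv1, hY0, hY1]
    match_scalars <;> field_simp
    ring
  have : FiniteDimensional ℂ T.ker := hK.finiteDimensional_ker_one_add
  have hker : T.ker = ⊥ := by
    refine ContinuousLinearMap.ker_eq_bot_of_intertwining hTD hr hYD (fun x hx => ?_) ?_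
    · exact e.eq_zero_of_forall_inner fun i => hY_zero i.1 x (hx _) (hx _) i.2
    · rintro x ⟨k, j⟩ hj h
      rw [hTx x k fun k' hk' j' => h _ fun h' => hk' (congrArg Prod.fst h')]
      refine smul_ne_zero (inv_ne_zero (hρ k)) ?_
      fin_cases j
      · rw [h (k, 1) (by simp), zero_smul, sub_zero]
        exact smul_ne_zero hj (hw _)
      · rw [h (k, 0) (by simp), zero_smul, zero_sub, neg_ne_zero]
        exact smul_ne_zero hj (hw _)
  have hunit : IsUnit T := hK.isUnit_one_add fun x hx => by
    have : x ∈ T.ker := hx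
    rwa [hker, Submodule.mem_bot] at this
  obtain ⟨u, hu⟩ := hunit
  refine ⟨e, ContinuousLinearEquiv.ofUnit u, fun i => ?_⟩
  rw [← hTe i, ← hu]
  rfl

end EigenvectorPairs

/-! ### The characteristic equation of the Hamiltonian operator. -/

noncomputable section Spectrum

variable {ω : ℕ → ℝ} {b : EllTwoReal}

theorem GapCondition.pos (hω : GapCondition ω) (k : ℕ) : 0 < ω k := by
  obtain ⟨h0, c, hc, h⟩ := hω
  induction k with
  | zero => exact h0
  | succ k ih => linarith [h k]

theorem GapCondition.strictMono (hω : GapCondition ω) : StrictMono ω := by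
  obtain ⟨-, c, hc, h⟩ := hω
  exact strictMono_nat_of_lt_succ fun k => by linarith [h k]

@[simp] theorem complexify_apply (b : EllTwoReal) (k : ℕ) : complexify b k = (b k : ℂ) := rfl

theorem EllTwoReal.summable_sq (b : EllTwoReal) : Summable fun k => b k ^ 2 := by
  simpa using (lp.memℓp b).summable (by norm_num)

/-- The functional `θ ↦ ½ b*(p - q)`. -/
def feedback (b : EllTwoReal) : StateSpace →L[ℂ] ℂ :=
  (1 / 2 : ℂ) • (innerSL ℂ (complexify b)).comp
    (PiLp.proj (𝕜 := ℂ) 2 (fun _ : Fin 4 => EllTwoComplex) 2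
      - PiLp.proj (𝕜 := ℂ) 2 (fun _ : Fin 4 => EllTwoComplex) 3)

theorem feedback_apply (x : StateSpace) :
    feedback b x = (1 / 2 : ℂ) * inner ℂ (complexify b) (x 2)
      - (1 / 2 : ℂ) * inner ℂ (complexify b) (x 3) := by
  simp [feedback, mul_sub]

theorem hasSum_feedback (x : StateSpace) :
    HasSum (fun j => (1 / 2 : ℂ) * (b j * (x 2 j - x 3 j))) (feedback b x) := by
  have h := ((lp.hasSum_inner (𝕜 := ℂ) (complexify b) (x 2)).sub
    (lp.hasSum_inner (𝕜 := ℂ) (complexify b) (x 3))).mul_left (1 / 2 : ℂ)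
  rw [mul_sub, ← feedback_apply] at h
  refine h.congr_fun fun j => ?_
  simp
  ring

/-- The signs `±i` in front of `Ω` in the components of `θ(σ)`. -/
def thetaPhase : Fin 4 → ℂ := ![Complex.I, -Complex.I, Complex.I, -Complex.I]

/-- The signs of the components of `θ(σ)`. -/
def thetaSign : Fin 4 → ℂ := ![1, -1, 1, -1]

/-- The powers of the resolvents in the components of `θ(σ)`. -/
def thetaPower : Fin 4 → ℕ := ![1, 1, 2, 2]

theorem norm_thetaPhase (m : Fin 4) : ‖thetaPhase m‖ = 1 := by
  fin_cases m <;> simp [thetaPhase]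

theorem thetaVec_apply (hω : GapCondition ω) (σ : ℂ) (m : Fin 4) (j : ℕ) :
    thetaVec ω b hω σ m j
      = thetaSign m * (((σ + thetaPhase m * ω j)⁻¹) ^ thetaPower m * b j) := by
  fin_cases m <;> rfl

theorem hasSum_feedback_thetaVec (hω : GapCondition ω) (σ : ℂ) :
    HasSum (fun j => (b j : ℂ) ^ 2 / 2
      * (((σ + Complex.I * ω j)⁻¹) ^ 2 + ((σ - Complex.I * ω j)⁻¹) ^ 2))
      (feedback b (thetaVec ω b hω σ)) := by
  refine (hasSum_feedback _).congr_fun fun j => ?_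
  simp only [thetaVec_apply]
  simp [thetaPhase, thetaSign, thetaPower, ← sub_eq_add_neg]
  ring

theorem mem_hamiltonianOp_domain {x : StateSpace} :
    x ∈ (hamiltonianOp ω b).domain ↔
      ∀ i, Memℓp (fun k => (ω k : ℂ) * x i k) 2 := Iff.rfl

/-- Since the rank-one coupling enters only through the number `feedback b x`, the eigenvalue
equation splits into scalar equations for each coordinate $j$. -/
theorem hamiltonianOp_eq_smul_iff {σ : ℂ} (x : (hamiltonianOp ω b).domain) :
    hamiltonianOp ω b x = σ • (x : StateSpace) ↔ ∀ j,
      feedback b x.1 * b j = (σ + Complex.I * ω j) * x.1 0 j ∧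
      -(feedback b x.1 * b j) = (σ - Complex.I * ω j) * x.1 1 j ∧
      x.1 0 j = (σ + Complex.I * ω j) * x.1 2 j ∧
      x.1 1 j = (σ - Complex.I * ω j) * x.1 3 j := by
  have h0 : ∀ j, (hamiltonianOp ω b x) 0 j
      = -(Complex.I * ω j * x.1 0 j) + feedback b x.1 * b j := by
    intro j
    rw [feedback_apply]
    change -Complex.I * (ω j * x.1 0 j)
      + (1 / 2 : ℂ) * inner ℂ (complexify b) (x.1 2) * b j
      - (1 / 2 : ℂ) * inner ℂ (complexify b) (x.1 3) * b j = _
    ring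
  have h1 : ∀ j, (hamiltonianOp ω b x) 1 j
      = Complex.I * ω j * x.1 1 j - feedback b x.1 * b j := by
    intro j
    rw [feedback_apply]
    change Complex.I * (ω j * x.1 1 j)
      - (1 / 2 : ℂ) * inner ℂ (complexify b) (x.1 2) * b j
      + (1 / 2 : ℂ) * inner ℂ (complexify b) (x.1 3) * b j = _
    ring
  have h2 : ∀ j, (hamiltonianOp ω b x) 2 j = x.1 0 j - Complex.I * ω j * x.1 2 j := by
    intro j
    change x.1 0 j - Complex.I * (ω j * x.1 2 j) = _
    ring
  have h3 : ∀ j, (hamiltonianOp ω b x) 3 j = x.1 1 j + Complex.I * ω j * x.1 3 j := by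
    intro j
    change x.1 1 j + Complex.I * (ω j * x.1 3 j) = _
    ring
  have hs : ∀ i j, (σ • x.1) i j = σ * x.1 i j := fun i j => rfl
  constructor
  · intro h j
    have e := fun i => congrArg (fun y : StateSpace => y i j) h
    have e0 := e 0
    have e1 := e 1
    have e2 := e 2
    have e3 := e 3
    simp only [h0, h1, h2, h3, hs] at e0 e1 e2 e3
    refine ⟨?_, ?_, ?_, ?_⟩
    · linear_combination e0
    · linear_combination e1
    · linear_combination e2
    · linear_combination e3
  · intro h
    refine PiLp.ext fun i => lp.ext (funext fun j => ?_)
    obtain ⟨e0, e1, e2, e3⟩ := h j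
    fin_cases i
    · exact (h0 j).trans (by rw [e0]; change _ = σ * x.1 0 j; ring)
    · exact (h1 j).trans (by rw [sub_eq_add_neg, e1]; change _ = σ * x.1 1 j; ring)
    · exact (h2 j).trans (by rw [e2]; change _ = σ * x.1 2 j; ring)
    · exact (h3 j).trans (by rw [e3]; change _ = σ * x.1 3 j; ring)

/-- With $r=(\sigma+s\omega)^{-1}$ and $s=\pm i$, one has $\omega r^{n+1}=s^{-1}(r^n-\sigma
r^{n+1})$, so multiplication by $\omega$ costs just one power of the resolvent. -/
theorem thetaVec_mem_domain (hω : GapCondition ω) {σ : ℂ}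
    (hσ : ∀ j, σ + Complex.I * ω j ≠ 0 ∧ σ - Complex.I * ω j ≠ 0) :
    thetaVec ω b hω σ ∈ (hamiltonianOp ω b).domain := by
  rw [mem_hamiltonianOp_domain]
  intro m
  obtain ⟨n, hn⟩ : ∃ n, thetaPower m = n + 1 := by
    fin_cases m
    exacts [⟨0, rfl⟩, ⟨0, rfl⟩, ⟨1, rfl⟩, ⟨1, rfl⟩]
  have hne : ∀ j, σ + thetaPhase m * ω j ≠ 0 := by
    intro j
    obtain ⟨h1, h2⟩ := hσ j
    fin_cases m <;> simpa [thetaPhase, ← sub_eq_add_neg]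
  have hs : thetaPhase m ≠ 0 := norm_ne_zero_iff.1 (by simp [norm_thetaPhase])
  have h1 := hω.memℓp_inv_pow b σ (thetaPhase m) (thetaSign m * (thetaPhase m)⁻¹)
    (norm_thetaPhase m) n
  have h2 := hω.memℓp_inv_pow b σ (thetaPhase m) (-(σ * (thetaSign m * (thetaPhase m)⁻¹)))
    (norm_thetaPhase m) (n + 1)
  convert h1.add h2 using 1
  funext j
  simp only [Pi.add_apply, thetaVec_apply, hn]
  have h3 := mul_inv_cancel₀ (hne j)
  have h4 := mul_inv_cancel₀ hs
  rw [pow_succ]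
  generalize ((σ + thetaPhase m * ω j)⁻¹) ^ n = P
  linear_combination thetaSign m * (thetaPhase m)⁻¹ * P * b j * h3
    - thetaSign m * P * b j * (σ + thetaPhase m * ω j)⁻¹ * ω j * h4

theorem thetaVec_ne_zero (hb : ∀ k, b k ≠ 0) (hω : GapCondition ω) {σ : ℂ}
    (hσ : ∀ j, σ + Complex.I * ω j ≠ 0 ∧ σ - Complex.I * ω j ≠ 0) :
    thetaVec ω b hω σ ≠ 0 := by
  intro h
  have h0 : thetaVec ω b hω σ 0 0 = 0 := by rw [h]; rfl
  rw [thetaVec_apply] at h0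
  simp [thetaSign, thetaPhase, thetaPower, hb] at h0
  exact (hσ 0).1 h0

theorem isEigenvectorOf_thetaVec (hb : ∀ k, b k ≠ 0) (hω : GapCondition ω) {σ : ℂ}
    (hσ : ∀ j, σ + Complex.I * ω j ≠ 0 ∧ σ - Complex.I * ω j ≠ 0)
    (h1 : feedback b (thetaVec ω b hω σ) = 1) :
    IsEigenvectorOf (hamiltonianOp ω b) σ (thetaVec ω b hω σ) := by
  refine ⟨thetaVec_ne_zero hb hω hσ, thetaVec_mem_domain hω hσ, ?_⟩
  refine (hamiltonianOp_eq_smul_iff ⟨_, thetaVec_mem_domain hω hσ⟩).2 fun j => ?_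
  obtain ⟨hp, hm⟩ := hσ j
  simp only [h1, thetaVec_apply]
  simp only [thetaSign, thetaPhase, thetaPower, Matrix.cons_val, ← sub_eq_add_neg, neg_mul]
  refine ⟨?_, ?_, ?_, ?_⟩ <;> field_simp

theorem eq_zero_of_feedback_eq_zero {x : StateSpace} (hb : ∀ k, b k ≠ 0) (k : ℕ)
    (hx : ∀ i j, (i = 2 ∨ i = 3) → j ≠ k → x i j = 0) (h0 : ∀ j, x 0 j = 0) (h1 : ∀ j, x 1 j = 0)
    (h23 : x 2 k = 0 ∨ x 3 k = 0) (hf : feedback b x = 0) : x = 0 := by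
  have h := (hasSum_feedback (b := b) x).unique (hasSum_single k fun j hj => by
    rw [hx 2 j (by simp) hj, hx 3 j (by simp) hj]; simp)
  rw [hf] at h
  have h' : x 2 k = x 3 k := by
    have : (b k : ℂ) ≠ 0 := by exact_mod_cast hb k
    simpa [this, sub_eq_zero] using h.symm
  have h2 : x 2 k = 0 := by
    rcases h23 with h2 | h3
    · exact h2
    · rw [h', h3]
  refine PiLp.ext fun i => lp.ext (funext fun j => ?_)
  fin_cases i
  · exact h0 j
  · exact h1 j
  · by_cases hj : j = k
    · subst hj; exact h2
    · exact hx 2 j (by simp) hj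
  · by_cases hj : j = k
    · subst hj; exact h' ▸ h2
    · exact hx 3 j (by simp) hj

/-- At $\sigma=\mp i\omega_k$ one scalar equation forces the feedback to vanish, since $b_k\ne0$.
All coordinates but one then vanish, and zero feedback kills that one as well. Elsewhere the
equations can be solved for $x=f(x)\,\theta(\sigma)$; applying $f$ and cancelling $f(x)\neq0$ gives
the characteristic equation. -/
theorem IsEigenvalueOf.ne_and_feedback (hb : ∀ k, b k ≠ 0) (hω : GapCondition ω) {σ : ℂ}
    (h : IsEigenvalueOf (hamiltonianOp ω b) σ) :
    (∀ j, σ + Complex.I * ω j ≠ 0 ∧ σ - Complex.I * ω j ≠ 0) ∧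
      feedback b (thetaVec ω b hω σ) = 1 := by
  obtain ⟨x, hx0, hx, hAx⟩ := h
  have he := (hamiltonianOp_eq_smul_iff ⟨x, hx⟩).1 hAx
  simp only at he
  have hbc : ∀ k, (b k : ℂ) ≠ 0 := fun k => by exact_mod_cast hb k
  have hσ : ∀ j, σ + Complex.I * ω j ≠ 0 ∧ σ - Complex.I * ω j ≠ 0 := by
    intro k
    constructor
    · intro hk
      have hf : feedback b x = 0 := by
        have := (he k).1
        rw [hk, zero_mul] at this
        exact (mul_eq_zero.1 this).resolve_right (hbc k)
      have hm : ∀ j, σ - Complex.I * ω j ≠ 0 := by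
        intro j hj
        have h2 : Complex.I * ((ω k + ω j : ℝ) : ℂ) = 0 := by
          push_cast
          linear_combination hk - hj
        have h3 := add_pos (hω.pos k) (hω.pos j)
        rcases mul_eq_zero.1 h2 with h | h
        · exact Complex.I_ne_zero h
        · exact h3.ne' (by exact_mod_cast h)
      have hp : ∀ j, j ≠ k → σ + Complex.I * ω j ≠ 0 := by
        intro j hjk hj
        have h2 : Complex.I * ((ω k : ℂ) - ω j) = 0 := by linear_combination hk - hj
        rcases mul_eq_zero.1 h2 with h | h
        · exact Complex.I_ne_zero h
        · exact hjk (hω.strictMono.injective (by exact_mod_cast (sub_eq_zero.1 h).symm))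
      have h1 : ∀ j, x 1 j = 0 := fun j => by
        have := (he j).2.1
        rw [hf, zero_mul, neg_zero] at this
        exact (mul_eq_zero.1 this.symm).resolve_left (hm j)
      have h3 : ∀ j, x 3 j = 0 := fun j => by
        have := (he j).2.2.2
        rw [h1] at this
        exact (mul_eq_zero.1 this.symm).resolve_left (hm j)
      have h0 : ∀ j, x 0 j = 0 := fun j => by
        by_cases hj : j = k
        · rw [(he j).2.2.1, hj, hk, zero_mul]
        · have := (he j).1
          rw [hf, zero_mul] at this
          exact (mul_eq_zero.1 this.symm).resolve_left (hp j hj)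
      have h2 : ∀ j, j ≠ k → x 2 j = 0 := fun j hj => by
        have := (he j).2.2.1
        rw [h0] at this
        exact (mul_eq_zero.1 this.symm).resolve_left (hp j hj)
      refine hx0 (eq_zero_of_feedback_eq_zero hb k ?_ h0 h1 (.inr (h3 k)) hf)
      rintro i j (rfl | rfl) hj
      exacts [h2 j hj, h3 j]
    · intro hk
      have hf : feedback b x = 0 := by
        have := (he k).2.1
        rw [hk, zero_mul, neg_eq_zero] at this
        exact (mul_eq_zero.1 this).resolve_right (hbc k)
      have hp : ∀ j, σ + Complex.I * ω j ≠ 0 := by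
        intro j hj
        have h2 : Complex.I * ((ω k + ω j : ℝ) : ℂ) = 0 := by
          push_cast
          linear_combination hj - hk
        have h3 := add_pos (hω.pos k) (hω.pos j)
        rcases mul_eq_zero.1 h2 with h | h
        · exact Complex.I_ne_zero h
        · exact h3.ne' (by exact_mod_cast h)
      have hm : ∀ j, j ≠ k → σ - Complex.I * ω j ≠ 0 := by
        intro j hjk hj
        have h2 : Complex.I * ((ω k : ℂ) - ω j) = 0 := by linear_combination hj - hk
        rcases mul_eq_zero.1 h2 with h | h
        · exact Complex.I_ne_zero h
        · exact hjk (hω.strictMono.injective (by exact_mod_cast (sub_eq_zero.1 h).symm))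
      have h0 : ∀ j, x 0 j = 0 := fun j => by
        have := (he j).1
        rw [hf, zero_mul] at this
        exact (mul_eq_zero.1 this.symm).resolve_left (hp j)
      have h2 : ∀ j, x 2 j = 0 := fun j => by
        have := (he j).2.2.1
        rw [h0] at this
        exact (mul_eq_zero.1 this.symm).resolve_left (hp j)
      have h1 : ∀ j, x 1 j = 0 := fun j => by
        by_cases hj : j = k
        · rw [(he j).2.2.2, hj, hk, zero_mul]
        · have := (he j).2.1
          rw [hf, zero_mul, neg_zero] at this
          exact (mul_eq_zero.1 this.symm).resolve_left (hm j hj)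
      have h3 : ∀ j, j ≠ k → x 3 j = 0 := fun j hj => by
        have := (he j).2.2.2
        rw [h1] at this
        exact (mul_eq_zero.1 this.symm).resolve_left (hm j hj)
      refine hx0 (eq_zero_of_feedback_eq_zero hb k ?_ h0 h1 (.inl (h2 k)) hf)
      rintro i j (rfl | rfl) hj
      exacts [h2 j, h3 j hj]
  refine ⟨hσ, ?_⟩
  have hxθ : x = feedback b x • thetaVec ω b hω σ := by
    refine PiLp.ext fun i => lp.ext (funext fun j => ?_)
    obtain ⟨hp, hm⟩ := hσ j
    obtain ⟨e0, e1, e2, e3⟩ := he j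
    change x i j = feedback b x * thetaVec ω b hω σ i j
    have f0 : x 0 j = feedback b x * ((σ + Complex.I * ω j)⁻¹ * b j) := by
      rw [eq_comm, ← mul_right_inj' hp, ← e0]; field_simp
    have f1 : x 1 j = -(feedback b x * ((σ - Complex.I * ω j)⁻¹ * b j)) := by
      rw [eq_comm, ← mul_right_inj' hm, ← e1]; field_simp
    rw [thetaVec_apply]
    fin_cases i
    · simpa [thetaSign, thetaPhase, thetaPower] using f0
    · simpa [thetaSign, thetaPhase, thetaPower, ← sub_eq_add_neg] using f1
    · have : x 2 j = feedback b x * ((σ + Complex.I * ω j)⁻¹ ^ 2 * b j) := by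
        rw [eq_comm, ← mul_right_inj' hp, ← e2, f0]; field_simp
      simpa [thetaSign, thetaPhase, thetaPower] using this
    · have : x 3 j = -(feedback b x * ((σ - Complex.I * ω j)⁻¹ ^ 2 * b j)) := by
        rw [eq_comm, ← mul_right_inj' hm, ← e3, f1]; field_simp
      simpa [thetaSign, thetaPhase, thetaPower, ← sub_eq_add_neg] using this
  have hf : feedback b x ≠ 0 := by
    intro hf
    rw [hf, zero_smul] at hxθ
    exact hx0 hxθ
  have := congrArg (feedback b) hxθ
  rw [map_smul, smul_eq_mul] at this
  exact mul_left_cancel₀ hf (by rw [← this, mul_one])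

end Spectrum

/-! ### A bounded operator with the same eigenvectors. -/

noncomputable section Resolvent

variable {ω : ℕ → ℝ} {b : EllTwoReal}

theorem memℓp_bounded_mul {g : ℕ → ℂ} {C : ℝ} (hC : ∀ k, ‖g k‖ ≤ C) (x : EllTwoComplex) :
    Memℓp (fun k => g k * x k) 2 := by
  refine ((lp.memℓp x).const_smul (C : ℂ)).mono' fun k => ?_
  have hC0 : 0 ≤ C := (norm_nonneg _).trans (hC 0)
  rw [Pi.smul_apply, smul_eq_mul, norm_mul, norm_mul, Complex.norm_real, Real.norm_eq_abs,
    abs_of_nonneg hC0]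
  exact mul_le_mul_of_nonneg_right (hC k) (norm_nonneg _)

/-- Multiplication of the coordinates of `ℓ²(ℂ)` by a bounded sequence. -/
def diagMulLinear (g : ℕ → ℂ) (C : ℝ) (hC : ∀ k, ‖g k‖ ≤ C) :
    EllTwoComplex →ₗ[ℂ] EllTwoComplex where
  toFun x := ⟨fun k => g k * x k, memℓp_bounded_mul hC x⟩
  map_add' _ _ := lp.ext (funext fun _ => mul_add _ _ _)
  map_smul' _ _ := lp.ext (funext fun _ => mul_left_comm _ _ _)

theorem norm_diagMulLinear_le (g : ℕ → ℂ) (C : ℝ) (hC : ∀ k, ‖g k‖ ≤ C) (x : EllTwoComplex) :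
    ‖diagMulLinear g C hC x‖ ≤ C * ‖x‖ := by
  have hC0 : 0 ≤ C := (norm_nonneg _).trans (hC 0)
  have h : ‖diagMulLinear g C hC x‖ ≤ ‖(C : ℂ) • x‖ := by
    refine lp.norm_mono (by simp) fun k => ?_
    change ‖g k * x k‖ ≤ ‖(C : ℂ) * x k‖
    rw [norm_mul, norm_mul, Complex.norm_real, Real.norm_eq_abs, abs_of_nonneg hC0]
    exact mul_le_mul_of_nonneg_right (hC k) (norm_nonneg _)
  rwa [norm_smul, Complex.norm_real, Real.norm_eq_abs, abs_of_nonneg hC0] at h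

/-- Multiplication of the coordinates of `ℓ²(ℂ)` by a bounded sequence, as a bounded operator. -/
def diagMul (g : ℕ → ℂ) (C : ℝ) (hC : ∀ k, ‖g k‖ ≤ C) : EllTwoComplex →L[ℂ] EllTwoComplex :=
  (diagMulLinear g C hC).mkContinuous C (norm_diagMulLinear_le g C hC)

/-- The resolvent of the uncoupled operator (the operator without the `b b*` terms). -/
theorem exists_uncoupled_resolvent (hω : GapCondition ω) (s : ℂ) :
    ∃ R : StateSpace →L[ℂ] StateSpace, ∀ x j,
      R x 0 j = -((s + Complex.I * ω j)⁻¹ * x 0 j) ∧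
      R x 1 j = -((s - Complex.I * ω j)⁻¹ * x 1 j) ∧
      R x 2 j = -((s + Complex.I * ω j)⁻¹ * ((s + Complex.I * ω j)⁻¹ * x 0 j + x 2 j)) ∧
      R x 3 j = -((s - Complex.I * ω j)⁻¹ * ((s - Complex.I * ω j)⁻¹ * x 1 j + x 3 j)) := by
  obtain ⟨C, hC⟩ := hω.bounded_inv s Complex.I (by simp)
  obtain ⟨C', hC'⟩ := hω.bounded_inv s (-Complex.I) (by simp)
  simp only [neg_mul, ← sub_eq_add_neg] at hC'
  let M := diagMul _ C hC
  let M' := diagMul _ C' hC'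
  let p : (i : Fin 4) → StateSpace →L[ℂ] EllTwoComplex :=
    fun i => PiLp.proj (𝕜 := ℂ) 2 (fun _ : Fin 4 => EllTwoComplex) i
  let q := (PiLp.continuousLinearEquiv 2 ℂ (fun _ : Fin 4 => EllTwoComplex)).symm
  refine ⟨q.toContinuousLinearMap ∘L ContinuousLinearMap.pi ![-(M ∘L p 0), -(M' ∘L p 1),
      -(M ∘L (M ∘L p 0 + p 2)), -(M' ∘L (M' ∘L p 1 + p 3))], fun x j => ⟨rfl, rfl, rfl, rfl⟩⟩

/-- The first resolvent identity, as $\theta(\sigma)$ is minus the uncoupled resolvent at $\sigma$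
applied to $(b,-b,0,0)$. -/
theorem uncoupled_resolvent_thetaVec (hω : GapCondition ω) {s σ : ℂ}
    {R : StateSpace →L[ℂ] StateSpace}
    (hR : ∀ x j,
      R x 0 j = -((s + Complex.I * ω j)⁻¹ * x 0 j) ∧
      R x 1 j = -((s - Complex.I * ω j)⁻¹ * x 1 j) ∧
      R x 2 j = -((s + Complex.I * ω j)⁻¹ * ((s + Complex.I * ω j)⁻¹ * x 0 j + x 2 j)) ∧
      R x 3 j = -((s - Complex.I * ω j)⁻¹ * ((s - Complex.I * ω j)⁻¹ * x 1 j + x 3 j)))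
    (hs : ∀ j, s + Complex.I * ω j ≠ 0 ∧ s - Complex.I * ω j ≠ 0)
    (hσ : ∀ j, σ + Complex.I * ω j ≠ 0 ∧ σ - Complex.I * ω j ≠ 0) :
    (σ - s) • R (thetaVec ω b hω σ) = thetaVec ω b hω σ - thetaVec ω b hω s := by
  refine PiLp.ext fun i => lp.ext (funext fun j => ?_)
  obtain ⟨h0, h1, h2, h3⟩ := hR (thetaVec ω b hω σ) j
  change (σ - s) * R (thetaVec ω b hω σ) i j = thetaVec ω b hω σ i j - thetaVec ω b hω s i j
  obtain ⟨hs1, hs2⟩ := hs j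
  obtain ⟨hσ1, hσ2⟩ := hσ j
  simp only [thetaVec_apply] at h0 h1 h2 h3 ⊢
  have e1 : (σ - s) = (σ + Complex.I * ω j) - (s + Complex.I * ω j) := by ring
  have e2 : (σ - s) = (σ - Complex.I * ω j) - (s - Complex.I * ω j) := by ring
  fin_cases i
  · simp only [Fin.zero_eta, h0]
    simp only [thetaSign, thetaPhase, thetaPower, Matrix.cons_val]
    rw [e1]
    generalize σ + Complex.I * ω j = u at *
    generalize s + Complex.I * ω j = t at *
    field_simp
    ring
  · simp only [Fin.mk_one, h1]
    simp only [thetaSign, thetaPhase, thetaPower, Matrix.cons_val, neg_mul, ← sub_eq_add_neg]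
    rw [e2]
    generalize σ - Complex.I * ω j = u at *
    generalize s - Complex.I * ω j = t at *
    field_simp
    ring
  · simp only [Fin.reduceFinMk, h2]
    simp only [thetaSign, thetaPhase, thetaPower, Matrix.cons_val]
    rw [e1]
    generalize σ + Complex.I * ω j = u at *
    generalize s + Complex.I * ω j = t at *
    field_simp
    ring
  · simp only [Fin.reduceFinMk, h3]
    simp only [thetaSign, thetaPhase, thetaPower, Matrix.cons_val, neg_mul, ← sub_eq_add_neg]
    rw [e2]
    generalize σ - Complex.I * ω j = u at *
    generalize s - Complex.I * ω j = t at *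
    field_simp
    ring

theorem add_I_mul_ne_zero_of_re_ne_zero {s : ℂ} (hs : s.re ≠ 0) (x : ℝ) :
    s + Complex.I * x ≠ 0 ∧ s - Complex.I * x ≠ 0 := by
  constructor <;> intro h <;> exact hs (by simpa using congrArg Complex.re h)

theorem norm_inv_sq_le_of_re {s : ℝ} (hs : 0 < s) {z : ℂ} (hz : z.re = s) :
    ‖z⁻¹ ^ 2‖ ≤ (s ^ 2)⁻¹ := by
  have h : s ≤ ‖z‖ := hz ▸ Complex.re_le_norm z
  rw [norm_pow, norm_inv, inv_pow]
  gcongr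

/-- At a real point $s>\|b\|$ the feedback has modulus at most $\|b\|^2/s^2<1$. This supplies a
point where the resolvent formula has nonzero denominator. -/
theorem feedback_thetaVec_ne_one (hω : GapCondition ω) :
    feedback b (thetaVec ω b hω ((‖b‖ + 1 : ℝ) : ℂ)) ≠ 1 := by
  set s : ℝ := ‖b‖ + 1 with hs
  have hs0 : 0 < s := by positivity
  have hb2 : HasSum (fun j => b j ^ 2 * (s ^ 2)⁻¹) (‖b‖ ^ 2 * (s ^ 2)⁻¹) := by
    have h := lp.hasSum_norm (p := 2) (by simp) b
    simp only [ENNReal.toReal_ofNat, Real.rpow_ofNat, Real.norm_eq_abs, sq_abs] at h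
    exact h.mul_right _
  have hle : ‖feedback b (thetaVec ω b hω (s : ℂ))‖ ≤ ‖b‖ ^ 2 * (s ^ 2)⁻¹ := by
    refine HasSum.norm_le_of_bounded (hasSum_feedback_thetaVec hω _) hb2 fun j => ?_
    have h1 : ‖((s : ℂ) + Complex.I * ω j)⁻¹ ^ 2‖ ≤ (s ^ 2)⁻¹ :=
      norm_inv_sq_le_of_re hs0 (by simp)
    have h2 : ‖((s : ℂ) - Complex.I * ω j)⁻¹ ^ 2‖ ≤ (s ^ 2)⁻¹ :=
      norm_inv_sq_le_of_re hs0 (by simp)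
    have h3 := norm_add_le (((s : ℂ) + Complex.I * ω j)⁻¹ ^ 2) (((s : ℂ) - Complex.I * ω j)⁻¹ ^ 2)
    have h4 : ‖(b j : ℂ) ^ 2 / 2‖ = b j ^ 2 / 2 := by simp
    rw [norm_mul, h4]
    nlinarith [sq_nonneg (b j)]
  intro h
  rw [h, norm_one, ← div_eq_mul_inv, one_le_div (by positivity)] at hle
  nlinarith [norm_nonneg b]

/-- There is a bounded operator of which all `θ(σ)`, `σ` an eigenvalue, are eigenvectors. -/
theorem exists_resolvent (hb : ∀ k, b k ≠ 0) (hω : GapCondition ω) :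
    ∃ (s : ℂ) (R : StateSpace →L[ℂ] StateSpace), ∀ σ, IsEigenvalueOf (hamiltonianOp ω b) σ →
      σ ≠ s ∧ R (thetaVec ω b hω σ) = (σ - s)⁻¹ • thetaVec ω b hω σ := by
  set s : ℂ := ((‖b‖ + 1 : ℝ) : ℂ) with hs
  have hs1 : feedback b (thetaVec ω b hω s) ≠ 1 := feedback_thetaVec_ne_one hω
  have hsre : s.re ≠ 0 := by
    rw [hs, Complex.ofReal_re]
    positivity
  obtain ⟨R₀, hR₀⟩ := exists_uncoupled_resolvent hω s
  -- Sherman–Morrison formula for $(\mathcal A-s)^{-1}$. Only its action on the vectors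
  -- $\theta(\sigma)$ is needed: the correction cancels the term $-\theta(s)$ left by `R₀` because
  -- $f(\theta(\sigma))=1$.
  refine ⟨s, R₀ + ((1 - feedback b (thetaVec ω b hω s))⁻¹ • feedback b ∘L R₀).smulRight
    (thetaVec ω b hω s), fun σ hσ => ?_⟩
  obtain ⟨hσ1, hσ2⟩ := hσ.ne_and_feedback hb hω
  have hne : σ ≠ s := by
    rintro rfl
    exact hs1 hσ2
  refine ⟨hne, ?_⟩
  have hne' := sub_ne_zero.2 hne
  have h1 : R₀ (thetaVec ω b hω σ)
      = (σ - s)⁻¹ • (thetaVec ω b hω σ - thetaVec ω b hω s) := by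
    rw [← uncoupled_resolvent_thetaVec hω hR₀
      (fun j => add_I_mul_ne_zero_of_re_ne_zero hsre _) hσ1, inv_smul_smul₀ hne']
  have h2 : 1 - feedback b (thetaVec ω b hω s) ≠ 0 := sub_ne_zero.2 hs1.symm
  simp only [add_apply, ContinuousLinearMap.smulRight_apply, smul_apply,
    ContinuousLinearMap.comp_apply, h1, map_smul, map_sub, hσ2, smul_eq_mul]
  match_scalars <;> field_simp
  ring

end Resolvent

/-! ### Localization of the eigenvalues near $i\omega_k+\lambda_k^0$. -/

noncomputable section Localization

/-- Dividing $\mu^2-\lambda^2=\lambda^2 Q(\mu)$, $Q=(g(0)-g)/g$, by $\mu+\lambda$ turns the equation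
into the fixed-point problem $\mu=\lambda+\lambda^2Q(\mu)/(\mu+\lambda)$. On the closed disc of
radius $\lambda/2$ about $\lambda$ the right side is a contraction with values in the open disc. -/
theorem existsUnique_sq_mul_eq_of_lipschitz {lam l : ℝ} (hlam : 0 < lam) {g : ℂ → ℂ}
    (hg0 : 1 ≤ ‖g 0‖) (hl : 0 ≤ l) (hsmall : l * lam ≤ 1 / 10)
    (hLip : ∀ μ μ', ‖μ‖ ≤ 2 * lam → ‖μ'‖ ≤ 2 * lam → ‖g μ - g μ'‖ ≤ l * ‖μ - μ'‖) :
    ∃! μ : ℂ, ‖μ - lam‖ < lam / 2 ∧ g μ * μ ^ 2 = g 0 * lam ^ 2 := by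
  set B : Set ℂ := Metric.closedBall (lam : ℂ) (lam / 2) with hB
  have hmem : ∀ μ, μ ∈ B ↔ ‖μ - lam‖ ≤ lam / 2 := fun μ => by
    rw [hB, Metric.mem_closedBall, dist_eq_norm]
  have hnl : ‖(lam : ℂ)‖ = lam := by simp [abs_of_pos hlam]
  have hnorm : ∀ μ ∈ B, ‖μ‖ ≤ 3 / 2 * lam := by
    intro μ hμ
    have h := norm_add_le (μ - lam) (lam : ℂ)
    rw [sub_add_cancel, hnl] at h
    linarith [(hmem μ).1 hμ]
  have hplus : ∀ μ ∈ B, 3 / 2 * lam ≤ ‖μ + lam‖ := by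
    intro μ hμ
    have h := norm_sub_norm_le (2 * lam : ℂ) (lam - μ)
    have h2 : ‖(2 * lam : ℂ)‖ = 2 * lam := by rw [norm_mul, hnl]; simp
    rw [h2, norm_sub_rev, show (2 * lam : ℂ) - (lam - μ) = μ + lam by ring] at h
    linarith [(hmem μ).1 hμ]
  have hg : ∀ μ ∈ B, ‖g 0 - g μ‖ ≤ 15 / 100 := by
    intro μ hμ
    have h := hLip 0 μ (by simp [hlam.le]) ((hnorm μ hμ).trans (by linarith))
    rw [zero_sub, norm_neg] at h
    nlinarith [hnorm μ hμ]
  have hgl : ∀ μ ∈ B, 85 / 100 * ‖g 0‖ ≤ ‖g μ‖ := by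
    intro μ hμ
    have h := norm_sub_norm_le (g 0) (g μ)
    linarith [hg μ hμ]
  have hgne : ∀ μ ∈ B, g μ ≠ 0 := fun μ hμ => norm_pos_iff.1 (by linarith [hgl μ hμ])
  have hpne : ∀ μ ∈ B, μ + lam ≠ 0 := fun μ hμ => norm_pos_iff.1 (by linarith [hplus μ hμ])
  let Q : ℂ → ℂ := fun μ => (g 0 - g μ) / g μ
  let Φ : ℂ → ℂ := fun μ => lam + lam ^ 2 * (Q μ / (μ + lam))
  -- The deviation of $g$ is at most $l\cdot\frac32\lambda\le 0.15$, and $0.15/0.85<0.18$ since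
  -- $|g(0)|\ge1$.
  have hQ : ∀ μ ∈ B, ‖Q μ‖ ≤ 18 / 100 := by
    intro μ hμ
    rw [norm_div, div_le_iff₀ (norm_pos_iff.2 (hgne μ hμ))]
    linarith [hg μ hμ, hgl μ hμ]
  have hQL : ∀ μ ∈ B, ∀ μ' ∈ B, ‖Q μ - Q μ'‖ ≤ 3 / 2 * l * ‖μ - μ'‖ := by
    intro μ hμ μ' hμ'
    have e : Q μ - Q μ' = g 0 * (g μ' - g μ) / (g μ * g μ') := by
      have h1 := hgne μ hμ
      have h2 := hgne μ' hμ'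
      simp only [Q]
      field_simp
      ring
    have h3 : ‖g μ' - g μ‖ ≤ l * ‖μ - μ'‖ := by
      rw [norm_sub_rev μ]
      exact hLip _ _ ((hnorm μ' hμ').trans (by linarith)) ((hnorm μ hμ).trans (by linarith))
    have h4 := hgl μ hμ
    have h5 := hgl μ' hμ'
    have h6 : ‖g 0‖ ≤ 3 / 2 * (‖g μ‖ * ‖g μ'‖) := by
      have : 85 / 100 * ‖g 0‖ * (85 / 100 * ‖g 0‖) ≤ ‖g μ‖ * ‖g μ'‖ := by gcongr
      nlinarith
    rw [e, norm_div, norm_mul, norm_mul, div_le_iff₀ (mul_pos (by linarith) (by linarith))]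
    calc ‖g 0‖ * ‖g μ' - g μ‖
        ≤ (3 / 2 * (‖g μ‖ * ‖g μ'‖)) * (l * ‖μ - μ'‖) := by gcongr
      _ = _ := by ring
  have hΦB : ∀ μ ∈ B, ‖Φ μ - lam‖ < lam / 2 := by
    intro μ hμ
    have h1 : ‖Q μ / (μ + lam)‖ ≤ 18 / 100 / (3 / 2 * lam) := by
      rw [norm_div]
      exact div_le_div₀ (by norm_num) (hQ μ hμ) (by linarith) (hplus μ hμ)
    simp only [Φ, add_sub_cancel_left, norm_mul, norm_pow, hnl]
    calc lam ^ 2 * ‖Q μ / (μ + lam)‖ ≤ lam ^ 2 * (18 / 100 / (3 / 2 * lam)) := by gcongr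
      _ = 12 / 100 * lam := by field_simp; norm_num
      _ < lam / 2 := by linarith
  have hΦL : ∀ μ ∈ B, ∀ μ' ∈ B, ‖Φ μ - Φ μ'‖ ≤ 1 / 2 * ‖μ - μ'‖ := by
    intro μ hμ μ' hμ'
    have h1 := hpne μ hμ
    have h2 := hpne μ' hμ'
    have e : Φ μ - Φ μ' = lam ^ 2 * ((Q μ - Q μ') / (μ + lam)
        + Q μ' * (μ' - μ) / ((μ + lam) * (μ' + lam))) := by
      simp only [Φ]
      field_simp
      ring
    have h3 : ‖(Q μ - Q μ') / (μ + lam)‖ ≤ (3 / 2 * l * ‖μ - μ'‖) / (3 / 2 * lam) := by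
      rw [norm_div]
      exact div_le_div₀ (by positivity) (hQL μ hμ μ' hμ') (by linarith) (hplus μ hμ)
    have h4 : ‖Q μ' * (μ' - μ) / ((μ + lam) * (μ' + lam))‖
        ≤ (18 / 100 * ‖μ - μ'‖) / ((3 / 2 * lam) * (3 / 2 * lam)) := by
      rw [norm_div, norm_mul, norm_mul, norm_sub_rev μ']
      exact div_le_div₀ (by positivity)
        (mul_le_mul_of_nonneg_right (hQ μ' hμ') (norm_nonneg _)) (by positivity)
        (mul_le_mul (hplus μ hμ) (hplus μ' hμ') (by positivity) (norm_nonneg _))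
    rw [e, norm_mul, norm_pow, hnl]
    calc lam ^ 2 * ‖(Q μ - Q μ') / (μ + lam) + Q μ' * (μ' - μ) / ((μ + lam) * (μ' + lam))‖
        ≤ lam ^ 2 * ((3 / 2 * l * ‖μ - μ'‖) / (3 / 2 * lam)
          + (18 / 100 * ‖μ - μ'‖) / ((3 / 2 * lam) * (3 / 2 * lam))) := by
          gcongr
          exact (norm_add_le _ _).trans (add_le_add h3 h4)
      _ = (l * lam + 8 / 100) * ‖μ - μ'‖ := by field_simp; ring
      _ ≤ 1 / 2 * ‖μ - μ'‖ := by gcongr; linarith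
  have hfix : ∀ μ ∈ B, (g μ * μ ^ 2 = g 0 * lam ^ 2 ↔ Φ μ = μ) := by
    intro μ hμ
    have h1 := hpne μ hμ
    have h2 := hgne μ hμ
    simp only [Φ, Q]
    constructor
    · intro h
      field_simp
      linear_combination -h
    · intro h
      field_simp at h
      linear_combination -h
  have hmaps : Set.MapsTo Φ B B := fun μ hμ => (hmem _).2 (hΦB μ hμ).le
  have hcontr : ContractingWith (1 / 2) (hmaps.restrict Φ B B) := by
    refine ⟨by norm_num, LipschitzWith.of_dist_le_mul fun x y => ?_⟩
    rw [Subtype.dist_eq, Subtype.dist_eq, dist_eq_norm, dist_eq_norm]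
    simpa using hΦL x x.2 y y.2
  have hlamB : (lam : ℂ) ∈ B := (hmem _).2 (by rw [sub_self, norm_zero]; positivity)
  obtain ⟨μ, hμ, hμfix, -⟩ := hcontr.exists_fixedPoint' Metric.isClosed_closedBall.isComplete hmaps
    hlamB (edist_ne_top _ _)
  have hμfix' : Φ μ = μ := hμfix
  refine ⟨μ, ⟨?_, (hfix μ hμ).2 hμfix'⟩, fun μ' hμ' => ?_⟩
  · have := hΦB μ hμ
    rwa [hμfix'] at this
  · have hμ'B : μ' ∈ B := (hmem _).2 hμ'.1.le
    have h := hΦL μ' hμ'B μ hμ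
    rw [hμfix', (hfix μ' hμ'B).1 hμ'.2] at h
    have : ‖μ' - μ‖ = 0 := by linarith [norm_nonneg (μ' - μ)]
    exact sub_eq_zero.1 (norm_eq_zero.1 this)

variable {ω : ℕ → ℝ} {b : EllTwoReal}

theorem GapCondition.exists_gap (hω : GapCondition ω) :
    ∃ c : ℝ, 0 < c ∧ (∀ k, c * (k + 1) ≤ ω k) ∧ ∀ j k, j ≠ k → c ≤ |ω j - ω k| := by
  obtain ⟨c, hc, h⟩ := hω.2
  have hm := hω.strictMono.monotone
  have key : ∀ j k, j < k → c ≤ ω k - ω j := fun j k hjk => by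
    have := hm (Nat.succ_le_of_lt hjk)
    linarith [h j]
  refine ⟨min c (ω 0), lt_min hc hω.1, fun k => ?_, fun j k hjk => (min_le_left _ _).trans ?_⟩
  · induction k with
    | zero => simp
    | succ k ih =>
      have := min_le_left c (ω 0)
      push_cast
      linarith [h k]
  · rcases hjk.lt_or_gt with hlt | hlt
    · rw [abs_sub_comm]
      exact (key _ _ hlt).trans (le_abs_self _)
    · exact (key _ _ hlt).trans (le_abs_self _)

/-- The weights `|b_j| / |ω_j - ω_k|` for `j ≠ k`, completed by `|b_k|` on the diagonal. -/
def gapWeight (ω b : ℕ → ℝ) (k j : ℕ) : ℝ :=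
  if j = k then |b k| else |b j| / |ω j - ω k|

theorem gapWeight_sq_of_ne {k j : ℕ} (h : j ≠ k) :
    gapWeight ω b k j ^ 2 = b j ^ 2 / (ω j - ω k) ^ 2 := by
  rw [gapWeight, if_neg h, div_pow, sq_abs, sq_abs]

theorem gapWeight_sq_self (k : ℕ) : gapWeight ω b k k ^ 2 = b k ^ 2 := by
  rw [gapWeight, if_pos rfl, sq_abs]

theorem summable_gapWeight_sq (hbω : DoubleSumCondition ω b) :
    Summable fun p : ℕ × ℕ => gapWeight ω b p.1 p.2 ^ 2 := by
  have h1 : Summable ({p : ℕ × ℕ | p.2 ≠ p.1}.indicator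
      fun p => b p.2 ^ 2 / (ω p.2 - ω p.1) ^ 2) := summable_subtype_iff_indicator.1 hbω
  have hinj : Function.Injective fun k : ℕ => (k, k) := fun _ _ h => congrArg Prod.fst h
  have h2 : Summable ({p : ℕ × ℕ | p.2 = p.1}.indicator fun p => b p.1 ^ 2) := by
    refine (hinj.summable_iff fun p hp => ?_).1 (b.summable_sq.congr fun k => ?_)
    · refine Set.indicator_of_notMem (fun h => hp ⟨p.1, Prod.ext rfl ?_⟩) _
      exact (show p.2 = p.1 from h).symm
    · simp
  refine (h1.add h2).congr fun p => ?_
  by_cases h : p.2 = p.1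
  · simp [Set.indicator, h, gapWeight_sq_self]
  · simp [Set.indicator, h, gapWeight_sq_of_ne h]

/-- `feedback(θ(iω_k + μ))` without its singular term `b_k² / (2μ²)`. -/
def regularPart (b : EllTwoReal) (hω : GapCondition ω) (k : ℕ) (μ : ℂ) : ℂ :=
  feedback b (thetaVec ω b hω (Complex.I * ω k + μ)) - (b k : ℂ) ^ 2 / 2 * μ⁻¹ ^ 2

/-- The terms of the series of the regular part. -/
def regularTerm (ω b : ℕ → ℝ) (k : ℕ) (μ : ℂ) (j : ℕ) : ℂ :=
  if j = k then (b k : ℂ) ^ 2 / 2 * (μ + Complex.I * ((2 * ω k : ℝ) : ℂ))⁻¹ ^ 2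
  else (b j : ℂ) ^ 2 / 2 * ((μ + Complex.I * ((ω k + ω j : ℝ) : ℂ))⁻¹ ^ 2
    + (μ + Complex.I * ((ω k - ω j : ℝ) : ℂ))⁻¹ ^ 2)

theorem hasSum_regularPart (hω : GapCondition ω) (k : ℕ) (μ : ℂ) :
    HasSum (regularTerm ω b k μ) (regularPart b hω k μ) := by
  refine ((hasSum_feedback_thetaVec hω (Complex.I * ω k + μ)).sub
    (hasSum_ite_eq k ((b k : ℂ) ^ 2 / 2 * μ⁻¹ ^ 2))).congr_fun fun j => ?_
  unfold regularTerm
  have e1 : Complex.I * ω k + μ + Complex.I * ω j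
      = μ + Complex.I * ((ω k + ω j : ℝ) : ℂ) := by push_cast; ring
  have e2 : Complex.I * ω k + μ - Complex.I * ω j
      = μ + Complex.I * ((ω k - ω j : ℝ) : ℂ) := by push_cast; ring
  rw [e1, e2]
  split_ifs with h
  · subst h
    simp only [sub_self, Complex.ofReal_zero, mul_zero, add_zero, two_mul]
    ring
  · simp

theorem norm_inv_add_le {μ x : ℂ} (hx : x ≠ 0) (hμ : ‖μ‖ ≤ ‖x‖ / 2) :
    ‖(μ + x)⁻¹‖ ≤ 2 / ‖x‖ := by
  have h0 := norm_pos_iff.2 hx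
  have h : ‖x‖ / 2 ≤ ‖μ + x‖ := by
    have := norm_sub_norm_le x (-μ)
    rw [norm_neg, sub_neg_eq_add, add_comm x] at this
    linarith
  rw [norm_inv, inv_le_comm₀ (by linarith) (by positivity), inv_div]
  exact h

/-- The difference has a natural bound of order $\|x\|^{-3}$; one factor is traded for $1/c$ so that
the weights of (A4) appear. -/
theorem norm_inv_sq_sub_le {μ μ' x : ℂ} {c : ℝ} (hc : 0 < c) (hx : c ≤ ‖x‖) (hμ : ‖μ‖ ≤ c / 2)
    (hμ' : ‖μ'‖ ≤ c / 2) :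
    ‖(μ + x)⁻¹ ^ 2 - (μ' + x)⁻¹ ^ 2‖ ≤ 16 / c / ‖x‖ ^ 2 * ‖μ - μ'‖ := by
  have hx0 : 0 < ‖x‖ := hc.trans_le hx
  have hne : ∀ ν : ℂ, ‖ν‖ ≤ c / 2 → ν + x ≠ 0 := by
    intro ν hν h
    have : x = -ν := (neg_eq_of_add_eq_zero_right h).symm
    rw [this, norm_neg] at hx
    linarith
  have h1 := norm_inv_add_le (norm_pos_iff.1 hx0) (hμ.trans (by linarith))
  have h2 := norm_inv_add_le (norm_pos_iff.1 hx0) (hμ'.trans (by linarith))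
  have e : (μ + x)⁻¹ ^ 2 - (μ' + x)⁻¹ ^ 2
      = (μ + x)⁻¹ * (μ' + x)⁻¹ * ((μ + x)⁻¹ + (μ' + x)⁻¹) * (μ' - μ) := by
    have h3 := hne μ hμ
    have h4 := hne μ' hμ'
    field_simp
    ring
  have h5 := norm_add_le (μ + x)⁻¹ (μ' + x)⁻¹
  rw [e, norm_mul, norm_mul, norm_mul, norm_sub_rev μ']
  calc ‖(μ + x)⁻¹‖ * ‖(μ' + x)⁻¹‖ * ‖(μ + x)⁻¹ + (μ' + x)⁻¹‖ * ‖μ - μ'‖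
      ≤ 2 / ‖x‖ * (2 / ‖x‖) * (4 / ‖x‖) * ‖μ - μ'‖ := by
        gcongr
        refine h5.trans ((add_le_add h1 h2).trans_eq (by ring))
    _ = 16 / ‖x‖ / ‖x‖ ^ 2 * ‖μ - μ'‖ := by ring
    _ ≤ 16 / c / ‖x‖ ^ 2 * ‖μ - μ'‖ := by gcongr

theorem norm_I_mul_ofReal (x : ℝ) : ‖Complex.I * (x : ℂ)‖ = |x| := by simp

theorem abs_sub_le_add_of_pos {x y : ℝ} (hx : 0 < x) (hy : 0 < y) : |x - y| ≤ x + y := by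
  rw [abs_le]
  constructor <;> linarith

theorem exists_regularPart_lipschitz (hω : GapCondition ω) (hbω : DoubleSumCondition ω b) :
    ∃ c L : ℝ, 0 < c ∧ 0 < L ∧ ∀ (k : ℕ) (μ μ' : ℂ), ‖μ‖ ≤ c → ‖μ'‖ ≤ c →
      ‖regularPart b hω k μ - regularPart b hω k μ'‖
        ≤ L * (∑' j, gapWeight ω b k j ^ 2) * ‖μ - μ'‖ := by
  obtain ⟨c, hc, hck, hcjk⟩ := hω.exists_gap
  have hck' : ∀ k, c ≤ ω k := fun k => by
    have : (0 : ℝ) ≤ k := k.cast_nonneg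
    nlinarith [hck k]
  refine ⟨c / 2, 16 / c + 8 / c / c ^ 2, by positivity, by positivity, fun k μ μ' hμ hμ' => ?_⟩
  have hrow : Summable fun j => gapWeight ω b k j ^ 2 :=
    (summable_gapWeight_sq hbω).prod_factor k
  refine HasSum.norm_le_of_bounded ((hasSum_regularPart hω k μ).sub (hasSum_regularPart hω k μ'))
    ((hrow.hasSum.mul_left _).mul_right _) fun j => ?_
  have hb2 : ∀ i, ‖(b i : ℂ) ^ 2 / 2‖ = b i ^ 2 / 2 := fun i => by simp
  unfold regularTerm
  split_ifs with h
  · subst h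
    rw [gapWeight_sq_self, ← mul_sub, norm_mul, hb2]
    have h1 := norm_inv_sq_sub_le (x := Complex.I * ((2 * ω j : ℝ) : ℂ)) hc
      (by rw [norm_I_mul_ofReal]; exact (by linarith [hck' j] : c ≤ 2 * ω j).trans (le_abs_self _))
      hμ hμ'
    rw [norm_I_mul_ofReal, sq_abs] at h1
    have h2 : 16 / c / (2 * ω j) ^ 2 ≤ 16 / c / c ^ 2 := by
      gcongr
      linarith [hck' j]
    calc b j ^ 2 / 2 * _ ≤ b j ^ 2 / 2 * (16 / c / (2 * ω j) ^ 2 * ‖μ - μ'‖) := by gcongr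
      _ ≤ b j ^ 2 / 2 * (16 / c / c ^ 2 * ‖μ - μ'‖) := by gcongr
      _ = 8 / c / c ^ 2 * b j ^ 2 * ‖μ - μ'‖ := by ring
      _ ≤ (16 / c + 8 / c / c ^ 2) * b j ^ 2 * ‖μ - μ'‖ := by
        gcongr
        have : 0 < 16 / c := by positivity
        linarith
  · rw [gapWeight_sq_of_ne h, ← mul_sub, norm_mul, hb2]
    have hd := hcjk j k h
    have hs : |ω j - ω k| ≤ |ω k + ω j| := by
      rw [abs_of_pos (add_pos (hω.pos k) (hω.pos j)), add_comm]
      exact abs_sub_le_add_of_pos (hω.pos j) (hω.pos k)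
    have h1 := norm_inv_sq_sub_le (x := Complex.I * ((ω k + ω j : ℝ) : ℂ)) hc
      (by rw [norm_I_mul_ofReal]; exact hd.trans hs) hμ hμ'
    have h2 := norm_inv_sq_sub_le (x := Complex.I * ((ω k - ω j : ℝ) : ℂ)) hc
      (by rw [norm_I_mul_ofReal, abs_sub_comm]; exact hd) hμ hμ'
    rw [norm_I_mul_ofReal] at h1 h2
    rw [abs_sub_comm] at h2
    have hd0 : 0 < |ω j - ω k| := hc.trans_le hd
    have h3 : 16 / c / |ω k + ω j| ^ 2 ≤ 16 / c / |ω j - ω k| ^ 2 := by gcongr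
    rw [add_sub_add_comm]
    calc b j ^ 2 / 2 * _ ≤ b j ^ 2 / 2 * (16 / c / |ω j - ω k| ^ 2 * ‖μ - μ'‖
          + 16 / c / |ω j - ω k| ^ 2 * ‖μ - μ'‖) := by
          gcongr
          refine (norm_add_le _ _).trans (add_le_add (h1.trans ?_) h2)
          gcongr
      _ = 16 / c * (b j ^ 2 / (ω j - ω k) ^ 2) * ‖μ - μ'‖ := by rw [sq_abs]; ring
      _ ≤ _ := by
        gcongr
        have : 0 < 8 / c / c ^ 2 := by positivity
        linarith

/-- The quantity under the square root in the definition of `λ⁰_k`, halved. -/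
theorem exists_regularPart_zero (hω : GapCondition ω) (k : ℕ) :
    ∃ G : ℝ, 1 ≤ G ∧ regularPart b hω k 0 = 1 - G ∧ lambdaZero ω b k = |b k| / √(2 * G) := by
  -- At $\mu=0$ every term contains $(ix)^{-2}=-x^{-2}$, so the series of the regular part is real
  -- with nonpositive terms, and $G=1+\sum_j\tau_j\ge1$.
  set τ : ℕ → ℝ := fun j => if j = k then b k ^ 2 / (8 * ω k ^ 2)
    else b j ^ 2 * (ω k ^ 2 + ω j ^ 2) / (ω k ^ 2 - ω j ^ 2) ^ 2 with hτ
  have hτ0 : ∀ j, 0 ≤ τ j := fun j => by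
    simp only [hτ]
    split_ifs <;> positivity
  have hterm : ∀ j, regularTerm ω b k 0 j = ((-τ j : ℝ) : ℂ) := by
    intro j
    have hI : Complex.I⁻¹ ^ 2 = -1 := by simp
    simp only [regularTerm, hτ, zero_add]
    split_ifs with h
    · have h1 : (ω k : ℂ) ≠ 0 := by exact_mod_cast (hω.pos k).ne'
      push_cast
      rw [mul_inv, mul_pow, hI]
      field_simp
      norm_num
    · have h1 : (ω k : ℂ) + ω j ≠ 0 := by
        exact_mod_cast (add_pos (hω.pos k) (hω.pos j)).ne'
      have h2 : (ω k : ℂ) - ω j ≠ 0 := by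
        rw [sub_ne_zero]
        exact_mod_cast fun h' => h (hω.strictMono.injective h').symm
      have h3 : (ω k : ℂ) ^ 2 - ω j ^ 2 = (ω k + ω j) * (ω k - ω j) := by ring
      push_cast
      rw [h3, mul_inv, mul_pow, hI, mul_inv, mul_pow, hI]
      field_simp
      ring
  have hsum := hasSum_regularPart (b := b) hω k 0
  rw [show regularTerm ω b k 0 = fun j => ((-τ j : ℝ) : ℂ) from funext hterm] at hsum
  have hsummable : Summable τ := by
    have : Summable fun j => -τ j := Complex.summable_ofReal.1 hsum.summable
    simpa using this.neg
  have hreg : regularPart b hω k 0 = ((-∑' j, τ j : ℝ) : ℂ) := by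
    refine hsum.unique ?_
    exact Complex.hasSum_ofReal.2 hsummable.hasSum.neg
  refine ⟨1 + ∑' j, τ j, ?_, ?_, ?_⟩
  · have : 0 ≤ ∑' j, τ j := tsum_nonneg hτ0
    linarith
  · rw [hreg]
    push_cast
    ring
  · unfold lambdaZero
    congr 2
    have h1 : ∑' j, τ j = τ k + ∑' j : {j : ℕ // j ≠ k}, τ j := by
      rw [hsummable.tsum_eq_add_tsum_ite k]
      congr 1
      have := tsum_subtype {j : ℕ | j ≠ k} τ
      refine Eq.trans (tsum_congr fun j => ?_) this.symm
      by_cases h : j = k <;> simp [Set.indicator, h]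
    have h2 : ∑' j : {j : ℕ // j ≠ k}, τ j = ∑' j : {j : ℕ // j ≠ k},
        b j ^ 2 * (ω k ^ 2 + ω j ^ 2) / (ω k ^ 2 - ω j ^ 2) ^ 2 :=
      tsum_congr fun j => if_neg j.2
    have h3 : τ k = b k ^ 2 / (8 * ω k ^ 2) := if_pos rfl
    have h4 := (hω.pos k).ne'
    rw [h1, h2, h3]
    field_simp
    ring

theorem lambdaZero_pos (hb : ∀ k, b k ≠ 0) (hω : GapCondition ω) (k : ℕ) :
    0 < lambdaZero ω b k := by
  obtain ⟨G, hG, -, h⟩ := exists_regularPart_zero (b := b) hω k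
  rw [h]
  have := abs_pos.2 (hb k)
  positivity

theorem lambdaZero_le (hω : GapCondition ω) (k : ℕ) : lambdaZero ω b k ≤ |b k| := by
  obtain ⟨G, hG, -, h⟩ := exists_regularPart_zero (b := b) hω k
  rw [h]
  refine div_le_self (abs_nonneg _) ?_
  rw [Real.one_le_sqrt]
  linarith

theorem EllTwoReal.tendsto_abs_zero (b : EllTwoReal) : Tendsto (fun k => |b k|) atTop (𝓝 0) := by
  have h := b.summable_sq.tendsto_atTop_zero.sqrt
  simpa [Real.sqrt_sq_eq_abs] using h

theorem tendsto_lambdaZero (hb : ∀ k, b k ≠ 0) (hω : GapCondition ω) :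
    Tendsto (lambdaZero ω b) atTop (𝓝 0) :=
  squeeze_zero (fun k => (lambdaZero_pos hb hω k).le) (fun k => lambdaZero_le hω k)
    b.tendsto_abs_zero

theorem re_pos_of_norm_sub_lt {μ : ℂ} {lam : ℝ} (h : ‖μ - lam‖ < lam / 2) : lam / 2 < μ.re := by
  have h1 := (Complex.abs_re_le_norm (μ - lam)).trans_lt h
  rw [Complex.sub_re, Complex.ofReal_re, abs_lt] at h1
  linarith

theorem eventually_existsUnique_eigenvalue (hb : ∀ k, b k ≠ 0) (hω : GapCondition ω)
    (hbω : DoubleSumCondition ω b) :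
    ∀ᶠ k in atTop, ∃! μ : ℂ, ‖μ - (lambdaZero ω b k : ℂ)‖ < lambdaZero ω b k / 2 ∧
      IsEigenvalueOf (hamiltonianOp ω b) (Complex.I * ω k + μ) := by
  obtain ⟨c, L, hc, hL, hLip⟩ := exists_regularPart_lipschitz hω hbω
  have hlim := tendsto_lambdaZero hb hω
  -- The row sums of a summable double series tend to zero.
  have hQ : Tendsto (fun k => ∑' j, gapWeight ω b k j ^ 2) atTop (𝓝 0) :=
    (summable_gapWeight_sq hbω).prod.tendsto_atTop_zero
  have hprod : Tendsto (fun k => L * (∑' j, gapWeight ω b k j ^ 2) * lambdaZero ω b k) atTop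
      (𝓝 0) := by
    simpa using (hQ.const_mul L).mul hlim
  filter_upwards [hprod.eventually_lt_const (by norm_num : (0 : ℝ) < 1 / 10),
    hlim.eventually_lt_const (by positivity : 0 < c / 2)] with k hk1 hk2
  have hlam := lambdaZero_pos hb hω k
  obtain ⟨G, hG, hG0, hlamG⟩ := exists_regularPart_zero (b := b) hω k
  have hsq : lambdaZero ω b k ^ 2 * (2 * G) = b k ^ 2 := by
    rw [hlamG, div_pow, sq_abs, Real.sq_sqrt (by linarith)]
    field_simp
  have h0 : 1 - regularPart b hω k 0 = (G : ℂ) := by rw [hG0]; ring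
  have key := existsUnique_sq_mul_eq_of_lipschitz (g := fun μ => 1 - regularPart b hω k μ)
    (l := L * ∑' j, gapWeight ω b k j ^ 2) hlam
    (by
      rw [h0, Complex.norm_real, Real.norm_eq_abs]
      exact hG.trans (le_abs_self _))
    (mul_nonneg hL.le (tsum_nonneg fun _ => sq_nonneg _)) hk1.le (fun μ μ' hμ hμ' => by
      rw [sub_sub_sub_cancel_left, norm_sub_rev]
      exact hLip k μ μ' (by linarith) (by linarith))
  refine (existsUnique_congr fun μ => and_congr_right fun hμ => ?_).1 key
  have hre : μ.re ≠ 0 := ne_of_gt (by linarith [re_pos_of_norm_sub_lt hμ])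
  have hμ0 : μ ≠ 0 := fun h => hre (by rw [h]; rfl)
  have hσre : (Complex.I * ω k + μ).re ≠ 0 := by simpa using hre
  have hGc : (lambdaZero ω b k : ℂ) ^ 2 * (2 * G) = (b k : ℂ) ^ 2 := by exact_mod_cast hsq
  have hiff : feedback b (thetaVec ω b hω (Complex.I * ω k + μ)) = 1 ↔
      (1 - regularPart b hω k μ) * μ ^ 2
        = (1 - regularPart b hω k 0) * (lambdaZero ω b k : ℂ) ^ 2 := by
    rw [h0]
    unfold regularPart
    constructor
    · intro h
      rw [h]
      field_simp
      linear_combination -hGc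
    · intro h
      field_simp at h
      refine mul_right_cancel₀ (pow_ne_zero 2 hμ0) ?_
      linear_combination (-1 / 2 : ℂ) * h - (1 / 2 : ℂ) * hGc
  rw [← hiff]
  constructor
  · intro h
    exact ⟨_, isEigenvectorOf_thetaVec hb hω
      (fun j => add_I_mul_ne_zero_of_re_ne_zero hσre _) h⟩
  · intro h
    exact (h.ne_and_feedback hb hω).2

end Localization

/-! ### The standard Hilbert basis of the state space. -/

noncomputable section StateBasis

/-- The standard orthonormal family of the state space. -/
def stateBasisVec (i : ℕ × Fin 4) : StateSpace :=
  PiLp.single 2 i.2 (lp.single 2 i.1 (1 : ℂ))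

theorem stateBasisVec_apply (i : ℕ × Fin 4) (m : Fin 4) (l : ℕ) :
    stateBasisVec i m l = if m = i.2 ∧ l = i.1 then 1 else 0 := by
  unfold stateBasisVec
  by_cases hm : m = i.2
  · subst hm
    rw [PiLp.single_eq_same, lp.single_apply]
    by_cases hl : l = i.1 <;> simp [hl]
  · rw [PiLp.single_eq_of_ne _ hm]
    simp [hm]

theorem inner_stateBasisVec (i : ℕ × Fin 4) (x : StateSpace) :
    inner ℂ (stateBasisVec i) x = x i.2 i.1 := by
  rw [PiLp.inner_apply, Finset.sum_eq_single i.2]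
  · unfold stateBasisVec
    rw [PiLp.single_eq_same, lp.inner_single_left]
    simp
  · intro m _ hm
    unfold stateBasisVec
    rw [PiLp.single_eq_of_ne _ hm, inner_zero_left]
  · simp

theorem orthonormal_stateBasisVec : Orthonormal ℂ stateBasisVec := by
  rw [orthonormal_iff_ite]
  intro i j
  rw [inner_stateBasisVec, stateBasisVec_apply]
  refine if_congr ?_ rfl rfl
  rw [Prod.ext_iff, and_comm]

/-- The standard Hilbert basis of the state space. -/
def stateBasis : HilbertBasis (ℕ × Fin 4) ℂ StateSpace :=
  HilbertBasis.mkOfOrthogonalEqBot orthonormal_stateBasisVec (by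
    rw [Submodule.eq_bot_iff]
    intro x hx
    refine PiLp.ext fun m => lp.ext (funext fun l => ?_)
    rw [← inner_stateBasisVec (l, m) x]
    exact (Submodule.mem_orthogonal _ _).1 hx _ (Submodule.subset_span ⟨(l, m), rfl⟩))

theorem stateBasis_apply (i : ℕ × Fin 4) : stateBasis i = stateBasisVec i := by
  simp [stateBasis]

theorem norm_sq_le_of_coord_le {x : StateSpace} {C : ℝ} {f : ℕ → ℝ}
    (hf : Summable fun l => f l ^ 2) (h : ∀ m l, ‖x m l‖ ≤ C * f l) :
    ‖x‖ ^ 2 ≤ 4 * C ^ 2 * ∑' l, f l ^ 2 := by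
  have h1 : ∀ m, ‖x m‖ ^ 2 ≤ C ^ 2 * ∑' l, f l ^ 2 := by
    intro m
    have h2 := lp.hasSum_norm (p := 2) (by simp) (x m)
    simp only [ENNReal.toReal_ofNat, Real.rpow_ofNat] at h2
    refine hasSum_le (fun l => ?_) h2 (hf.hasSum.mul_left (C ^ 2))
    rw [← mul_pow]
    exact pow_le_pow_left₀ (norm_nonneg _) (h m l) 2
  rw [PiLp.norm_sq_eq_of_L2]
  refine (Finset.sum_le_sum fun m _ => h1 m).trans_eq ?_
  simp
  ring

end StateBasis

/-! ### Scaled eigenvectors in blocks and their coordinates. -/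

noncomputable section RieszBasis

variable {ω : ℕ → ℝ} {b : EllTwoReal}

/-- The index of the component of `(z, ζ, p, q)` with phase `t` and power `n + 1`. -/
def componentIndex : Fin 2 × Fin 2 ≃ Fin 4 where
  toFun i := ![![0, 2], ![1, 3]] i.1 i.2
  invFun m := (![0, 1, 0, 1] m, ![0, 0, 1, 1] m)
  left_inv := by decide
  right_inv := by decide

/-- The phase `±i` of a block. -/
def blockPhase : Fin 2 → ℂ := ![Complex.I, -Complex.I]

/-- The sign of a block. -/
def blockSign : Fin 2 → ℂ := ![1, -1]

theorem thetaPhase_componentIndex (i : Fin 2 × Fin 2) :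
    thetaPhase (componentIndex i) = blockPhase i.1 := by
  obtain ⟨t, n⟩ := i
  fin_cases t <;> fin_cases n <;> rfl

theorem thetaSign_componentIndex (i : Fin 2 × Fin 2) :
    thetaSign (componentIndex i) = blockSign i.1 := by
  obtain ⟨t, n⟩ := i
  fin_cases t <;> fin_cases n <;> rfl

theorem thetaPower_componentIndex (i : Fin 2 × Fin 2) :
    thetaPower (componentIndex i) = i.2.val + 1 := by
  obtain ⟨t, n⟩ := i
  fin_cases t <;> fin_cases n <;> rfl

theorem blockSign_mul_self (t : Fin 2) : blockSign t * blockSign t = 1 := by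
  fin_cases t <;> simp [blockSign]

theorem norm_blockSign (t : Fin 2) : ‖blockSign t‖ = 1 := by
  fin_cases t <;> simp [blockSign]

theorem blockSign_ne_zero (t : Fin 2) : blockSign t ≠ 0 :=
  norm_ne_zero_iff.1 (by simp [norm_blockSign])

theorem norm_blockPhase (t : Fin 2) : ‖blockPhase t‖ = 1 := by
  fin_cases t <;> simp [blockPhase]

/-- The distance of the eigenvalues of a block from the eigenvalue of the uncoupled operator. -/
def blockShift (ν : ℕ → ℂ) (i : (ℕ × Fin 2) × Fin 2) : ℂ :=
  ![![(starRingEnd ℂ) (ν i.1.1), -ν i.1.1], ![ν i.1.1, -(starRingEnd ℂ) (ν i.1.1)]] i.1.2 i.2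

theorem norm_blockShift (ν : ℕ → ℂ) (i : (ℕ × Fin 2) × Fin 2) :
    ‖blockShift ν i‖ = ‖ν i.1.1‖ := by
  obtain ⟨⟨k, t⟩, j⟩ := i
  fin_cases t <;> fin_cases j <;> simp [blockShift]

theorem blockShift_sub (ν : ℕ → ℂ) (i : ℕ × Fin 2) :
    blockShift ν (i, 0) - blockShift ν (i, 1) = 2 * ((ν i.1).re : ℂ) := by
  obtain ⟨k, t⟩ := i
  have h := Complex.add_conj (ν k)
  push_cast at h
  fin_cases t <;> simp [blockShift, ← h, add_comm]

/-- The eigenvalues, arranged in blocks. -/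
def blockSigma (ω : ℕ → ℝ) (ν : ℕ → ℂ) (i : (ℕ × Fin 2) × Fin 2) : ℂ :=
  -(blockPhase i.1.2 * ω i.1.1) + blockShift ν i

/-- The position of an eigenvalue of a block in the list of all eigenvalues. -/
def sigmaIndex (i : (ℕ × Fin 2) × Fin 2) : ℕ × Fin 4 :=
  (i.1.1, ![![2, 3], ![0, 1]] i.1.2 i.2)

theorem sigmaFamily_sigmaIndex (ω : ℕ → ℝ) (ν : ℕ → ℂ) (i : (ℕ × Fin 2) × Fin 2) :
    sigmaFamily ω ν (sigmaIndex i) = blockSigma ω ν i := by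
  obtain ⟨⟨k, t⟩, j⟩ := i
  fin_cases t <;> fin_cases j <;>
    simp [sigmaFamily, sigmaIndex, blockSigma, blockShift, blockPhase, sigmaUpPlus, sigmaUpMinus,
      sigmaDownPlus, sigmaDownMinus, sub_eq_add_neg]

theorem sigmaIndex_injective : Function.Injective sigmaIndex := by
  have h : Function.Injective fun i : Fin 2 × Fin 2 =>
    (![![2, 3], ![0, 1]] i.1 i.2 : Fin 4) := by decide
  rintro ⟨⟨k, t⟩, j⟩ ⟨⟨k', t'⟩, j'⟩ hij
  obtain ⟨h1, h2⟩ := Prod.ext_iff.1 hij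
  have h3 : (t, j) = (t', j') := h h2
  simp only [Prod.mk.injEq] at h3 ⊢
  exact ⟨⟨h1, h3.1⟩, h3.2⟩

theorem IsSpectralLabelling.blockSigma_injective {ν : ℕ → ℂ} (hν : IsSpectralLabelling ω b ν) :
    Function.Injective (blockSigma ω ν) := by
  have : blockSigma ω ν = sigmaFamily ω ν ∘ sigmaIndex :=
    funext fun i => (sigmaFamily_sigmaIndex ω ν i).symm
  rw [this]
  exact hν.injective.comp sigmaIndex_injective

theorem IsSpectralLabelling.isEigenvalueOf_blockSigma {ν : ℕ → ℂ}
    (hν : IsSpectralLabelling ω b ν) (i : (ℕ × Fin 2) × Fin 2) :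
    IsEigenvalueOf (hamiltonianOp ω b) (blockSigma ω ν i) :=
  sigmaFamily_sigmaIndex ω ν i ▸ hν.isEigenvalue _

theorem blockSigma_sub (ω : ℕ → ℝ) (ν : ℕ → ℂ) (i : ℕ × Fin 2) :
    blockSigma ω ν (i, 0) - blockSigma ω ν (i, 1) = 2 * ((ν i.1).re : ℂ) := by
  rw [← blockShift_sub]
  simp [blockSigma]

/-- The two eigenvalues of a block differ by $2\,\mathrm{Re}\,\nu_k$, and they are distinct. -/
theorem IsSpectralLabelling.re_ne_zero {ν : ℕ → ℂ} (hν : IsSpectralLabelling ω b ν) (k : ℕ) :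
    (ν k).re ≠ 0 := by
  intro h
  have h1 := blockSigma_sub ω ν (k, 0)
  rw [h, Complex.ofReal_zero, mul_zero] at h1
  have h2 := hν.blockSigma_injective (sub_eq_zero.1 h1)
  simp at h2

/-- The eigenvectors of a block, scaled so that their sums and scaled differences are the vectors
of the family `thetaFamily`. -/
def blockVec (ω : ℕ → ℝ) (b : EllTwoReal) (hω : GapCondition ω) (ν : ℕ → ℂ)
    (i : (ℕ × Fin 2) × Fin 2) : StateSpace :=
  (blockSign i.1.2 * blockShift ν i ^ 2 / (2 * b i.1.1)) • thetaVec ω b hω (blockSigma ω ν i)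

/-- The index set of `thetaFamily`, arranged in blocks. -/
def blockIndex : (ℕ × Fin 2) × Fin 2 ≃ ℕ × Fin 4 :=
  (Equiv.prodAssoc _ _ _).trans ((Equiv.refl _).prodCongr componentIndex)

theorem blockIndex_apply (k : ℕ) (t j : Fin 2) :
    blockIndex ((k, t), j) = (k, componentIndex (t, j)) := rfl

theorem thetaFamily_blockIndex_zero (hω : GapCondition ω) (ν : ℕ → ℂ) (i : ℕ × Fin 2) :
    thetaFamily ω b hω ν (blockIndex (i, 0)) = ((ν i.1).re : ℂ)⁻¹ •
      (blockVec ω b hω ν (i, 0) - blockVec ω b hω ν (i, 1)) := by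
  obtain ⟨k, t⟩ := i
  have h0 := sigmaFamily_sigmaIndex ω ν ((k, t), 0)
  have h1 := sigmaFamily_sigmaIndex ω ν ((k, t), 1)
  unfold blockVec
  rw [← h0, ← h1]
  fin_cases t
  · change thetaZ ω b hω ν k = ((ν k).re : ℂ)⁻¹ •
      ((1 * (starRingEnd ℂ) (ν k) ^ 2 / (2 * b k)) • thetaVec ω b hω (sigmaDownPlus ω ν k)
        - (1 * (-ν k) ^ 2 / (2 * b k)) • thetaVec ω b hω (sigmaDownMinus ω ν k))
    rw [thetaZ]
    match_scalars <;> ring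
  · change thetaZeta ω b hω ν k = ((ν k).re : ℂ)⁻¹ •
      ((-1 * ν k ^ 2 / (2 * b k)) • thetaVec ω b hω (sigmaUpPlus ω ν k)
        - (-1 * (-(starRingEnd ℂ) (ν k)) ^ 2 / (2 * b k)) • thetaVec ω b hω (sigmaUpMinus ω ν k))
    rw [thetaZeta]
    match_scalars <;> ring

theorem thetaFamily_blockIndex_one (hω : GapCondition ω) (ν : ℕ → ℂ) (i : ℕ × Fin 2) :
    thetaFamily ω b hω ν (blockIndex (i, 1))
      = blockVec ω b hω ν (i, 0) + blockVec ω b hω ν (i, 1) := by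
  obtain ⟨k, t⟩ := i
  have h0 := sigmaFamily_sigmaIndex ω ν ((k, t), 0)
  have h1 := sigmaFamily_sigmaIndex ω ν ((k, t), 1)
  unfold blockVec
  rw [← h0, ← h1]
  fin_cases t
  · change thetaP ω b hω ν k =
      (1 * (starRingEnd ℂ) (ν k) ^ 2 / (2 * b k)) • thetaVec ω b hω (sigmaDownPlus ω ν k)
        + (1 * (-ν k) ^ 2 / (2 * b k)) • thetaVec ω b hω (sigmaDownMinus ω ν k)
    rw [thetaP]
    match_scalars <;> ring
  · change thetaQ ω b hω ν k =
      (-1 * ν k ^ 2 / (2 * b k)) • thetaVec ω b hω (sigmaUpPlus ω ν k)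
        + (-1 * (-(starRingEnd ℂ) (ν k)) ^ 2 / (2 * b k)) • thetaVec ω b hω (sigmaUpMinus ω ν k)
    rw [thetaQ]
    match_scalars <;> ring

theorem blockVec_apply (hω : GapCondition ω) (ν : ℕ → ℂ) (k : ℕ) (t j t' n : Fin 2) (l : ℕ) :
    blockVec ω b hω ν ((k, t), j) (componentIndex (t', n)) l
      = blockSign t * blockSign t' * (blockShift ν ((k, t), j) ^ 2 / (2 * b k)
        * (((blockShift ν ((k, t), j) + (blockPhase t' * ω l - blockPhase t * ω k))⁻¹)
          ^ (n.val + 1) * b l)) := by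
  change (blockSign t * blockShift ν ((k, t), j) ^ 2 / (2 * b k))
    * thetaVec ω b hω (blockSigma ω ν ((k, t), j)) (componentIndex (t', n)) l = _
  rw [thetaVec_apply, thetaPhase_componentIndex, thetaSign_componentIndex,
    thetaPower_componentIndex]
  have : blockSigma ω ν ((k, t), j) + blockPhase t' * ω l
      = blockShift ν ((k, t), j) + (blockPhase t' * ω l - blockPhase t * ω k) := by
    simp only [blockSigma]
    ring
  rw [this]
  ring

/-- The scaling by the squared shift over $2b_k$ is chosen for this: in their own block the
coordinates are half the shift and $\frac12$. -/
theorem blockVec_apply_self (hb : ∀ k, b k ≠ 0) (hω : GapCondition ω) (ν : ℕ → ℂ) (k : ℕ)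
    (t j n : Fin 2) :
    blockVec ω b hω ν ((k, t), j) (componentIndex (t, n)) k
      = blockShift ν ((k, t), j) ^ 2 * (blockShift ν ((k, t), j))⁻¹ ^ (n.val + 1) / 2 := by
  have : (b k : ℂ) ≠ 0 := by exact_mod_cast hb k
  rw [blockVec_apply, blockSign_mul_self, sub_self, add_zero]
  field_simp

theorem norm_blockPhase_mul_sub (hω : GapCondition ω) (t t' : Fin 2) (k l : ℕ) :
    |ω l - ω k| ≤ ‖blockPhase t' * ω l - blockPhase t * ω k‖ ∧
      (t ≠ t' → 2 * ω k = ‖blockPhase t' * ω k - blockPhase t * ω k‖) := by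
  have hn : ∀ s j, ‖blockPhase s * ω j‖ = ω j := fun s j => by
    rw [norm_mul, norm_blockPhase, one_mul, Complex.norm_real, Real.norm_eq_abs,
      abs_of_pos (hω.pos j)]
  refine ⟨?_, fun h => ?_⟩
  · have := abs_norm_sub_norm_le (blockPhase t' * ω l) (blockPhase t * ω k)
    rwa [hn, hn] at this
  · have h2 : blockPhase t = -blockPhase t' := by
      fin_cases t <;> fin_cases t' <;> simp_all [blockPhase]
    rw [h2, neg_mul, sub_neg_eq_add, ← two_mul, norm_mul, hn]
    simp

/-- Off the diagonal, the scaled eigenvectors are controlled by the weights `gapWeight`. -/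
theorem exists_norm_blockVec_le (hω : GapCondition ω) :
    ∃ c C : ℝ, 0 < c ∧ 0 < C ∧ ∀ (ν : ℕ → ℂ) (k : ℕ) (t j t' n : Fin 2) (l : ℕ), ‖ν k‖ ≤ c →
      ¬(t = t' ∧ l = k) → ‖blockVec ω b hω ν ((k, t), j) (componentIndex (t', n)) l‖
        ≤ ‖ν k‖ ^ 2 / (2 * |b k|) * (C * gapWeight ω b k l) := by
  obtain ⟨c, hc, hck, hcjk⟩ := hω.exists_gap
  have hck' : ∀ k, c ≤ ω k := fun k => by
    have : (0 : ℝ) ≤ k := k.cast_nonneg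
    nlinarith [hck k]
  -- The first factor covers both resolvent powers; the second also covers $l=k$ with opposite
  -- phase, where the pole is at distance $2\omega_k\ge c$.
  refine ⟨c / 2, (2 + 4 / c) * (1 + 1 / c), by positivity, by positivity,
    fun ν k t j t' n l hν htl => ?_⟩
  obtain ⟨hx1, hx2⟩ := norm_blockPhase_mul_sub hω t t' k l
  rw [blockVec_apply]
  set x : ℂ := blockPhase t' * ω l - blockPhase t * ω k with hx
  have hcx : c ≤ ‖x‖ ∧ |b l| / ‖x‖ ≤ (1 + 1 / c) * gapWeight ω b k l := by
    by_cases hl : l = k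
    · subst hl
      have hxl : 2 * ω l = ‖x‖ := hx2 fun h => htl ⟨h, rfl⟩
      have hcx : c ≤ ‖x‖ := by linarith [hck' l]
      refine ⟨hcx, ?_⟩
      rw [gapWeight, if_pos rfl]
      calc |b l| / ‖x‖ ≤ |b l| / c := by gcongr
        _ = 1 / c * |b l| := by ring
        _ ≤ (1 + 1 / c) * |b l| := by gcongr; linarith
    · have hd := hcjk l k hl
      have hd0 : 0 < |ω l - ω k| := hc.trans_le hd
      refine ⟨hd.trans hx1, ?_⟩
      rw [gapWeight, if_neg hl]
      calc |b l| / ‖x‖ ≤ 1 * (|b l| / |ω l - ω k|) := by rw [one_mul]; gcongr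
        _ ≤ (1 + 1 / c) * (|b l| / |ω l - ω k|) := by
          gcongr
          have : 0 < 1 / c := by positivity
          linarith
  obtain ⟨hcx, hbx⟩ := hcx
  have hx0 : 0 < ‖x‖ := hc.trans_le hcx
  have hinv : ‖(blockShift ν ((k, t), j) + x)⁻¹‖ ≤ 2 / ‖x‖ :=
    norm_inv_add_le (norm_pos_iff.1 hx0) (by rw [norm_blockShift]; simp only; linarith)
  have hpow : ‖(blockShift ν ((k, t), j) + x)⁻¹ ^ (n.val + 1)‖ ≤ (2 + 4 / c) / ‖x‖ := by
    rw [norm_pow]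
    refine (pow_le_pow_left₀ (norm_nonneg _) hinv _).trans ?_
    fin_cases n
    · simp only [zero_add, pow_one]
      gcongr
      have : 0 < 4 / c := by positivity
      linarith
    · calc (2 / ‖x‖) ^ 2 = 4 / ‖x‖ / ‖x‖ := by ring
        _ ≤ 4 / c / ‖x‖ := by gcongr
        _ ≤ (2 + 4 / c) / ‖x‖ := by gcongr; linarith
  have hbk : ‖(2 * b k : ℂ)‖ = 2 * |b k| := by simp
  have hbl : ‖(b l : ℂ)‖ = |b l| := by simp
  rw [norm_mul, norm_mul, norm_blockSign, norm_blockSign, one_mul, one_mul, norm_mul, norm_div,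
    norm_pow, norm_blockShift, hbk, norm_mul, hbl]
  refine mul_le_mul_of_nonneg_left ?_ (by positivity)
  calc ‖(blockShift ν ((k, t), j) + x)⁻¹ ^ (n.val + 1)‖ * |b l|
      ≤ (2 + 4 / c) / ‖x‖ * |b l| := by gcongr
    _ = (2 + 4 / c) * (|b l| / ‖x‖) := by ring
    _ ≤ (2 + 4 / c) * ((1 + 1 / c) * gapWeight ω b k l) := by gcongr
    _ = _ := by ring

end RieszBasis

/-! ### Quadratic closeness and the main theorem. -/

noncomputable section MainTheorem

variable {ω : ℕ → ℝ} {b : EllTwoReal}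

/-- Within its own block the combination matches the basis vector exactly, except for one entry of
the sum, which is the mean of the two shifts. -/
theorem thetaFamily_sub_stateBasis_self (hb : ∀ k, b k ≠ 0) (hω : GapCondition ω) {ν : ℕ → ℂ}
    {k : ℕ} (hν : (ν k).re ≠ 0) (t j n : Fin 2) :
    ‖(thetaFamily ω b hω ν (blockIndex ((k, t), j)) - stateBasis (blockIndex ((k, t), j)))
      (componentIndex (t, n)) k‖ ≤ ‖ν k‖ := by
  have hρ : ((ν k).re : ℂ) ≠ 0 := by exact_mod_cast hν
  have hsub := blockShift_sub ν (k, t)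
  have hne : ∀ j, blockShift ν ((k, t), j) ≠ 0 := fun j => by
    rw [← norm_pos_iff, norm_blockShift, norm_pos_iff]
    intro h
    exact hν (by simp only at h; rw [h]; rfl)
  have h0 := hne 0
  have h1 := hne 1
  have hnorm : ∀ j, ‖blockShift ν ((k, t), j)‖ = ‖ν k‖ := fun j => norm_blockShift _ _
  have hv := fun j => blockVec_apply_self hb hω ν k t j n
  have hs : ∀ x y : StateSpace, (x - y) (componentIndex (t, n)) k
      = x (componentIndex (t, n)) k - y (componentIndex (t, n)) k := fun _ _ => rfl
  have ha : ∀ x y : StateSpace, (x + y) (componentIndex (t, n)) k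
      = x (componentIndex (t, n)) k + y (componentIndex (t, n)) k := fun _ _ => rfl
  have hc : ∀ (c : ℂ) (x : StateSpace), (c • x) (componentIndex (t, n)) k
      = c * x (componentIndex (t, n)) k := fun _ _ => rfl
  rw [hs, stateBasis_apply, stateBasisVec_apply, blockIndex_apply]
  simp only [componentIndex.injective.eq_iff, Prod.mk.injEq, true_and, and_true]
  rw [← blockIndex_apply]
  simp only at hsub
  generalize hκ0 : blockShift ν ((k, t), 0) = κ₀ at *
  generalize hκ1 : blockShift ν ((k, t), 1) = κ₁ at *
  have hn0 := hnorm 0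
  have hn1 := hnorm 1
  have hv0 := hv 0
  have hv1 := hv 1
  rw [hκ0] at hn0 hv0
  rw [hκ1] at hn1 hv1
  fin_cases j
  · change ‖thetaFamily ω b hω ν (blockIndex ((k, t), 0)) (componentIndex (t, n)) k - _‖ ≤ _
    rw [thetaFamily_blockIndex_zero, hc, hs, hv0, hv1]
    refine le_of_eq_of_le ?_ (norm_nonneg (ν k))
    rw [norm_eq_zero]
    fin_cases n
    · simp only [Fin.zero_eta, zero_add, pow_one, if_true]
      field_simp
      linear_combination hsub
    · have e : ∀ x : ℂ, x ≠ 0 → x ^ 2 * (x ^ 2)⁻¹ = 1 := fun x hx =>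
        mul_inv_cancel₀ (pow_ne_zero 2 hx)
      simp [e _ h0, e _ h1]
  · change ‖thetaFamily ω b hω ν (blockIndex ((k, t), 1)) (componentIndex (t, n)) k - _‖ ≤ _
    rw [thetaFamily_blockIndex_one, ha, hv0, hv1]
    fin_cases n
    · have e : κ₀ ^ 2 * κ₀⁻¹ ^ (0 + 1) / 2 + κ₁ ^ 2 * κ₁⁻¹ ^ (0 + 1) / 2 - 0 = (κ₀ + κ₁) / 2 := by
        rw [zero_add, pow_one, pow_one]
        field_simp
        ring
      have h := norm_add_le κ₀ κ₁
      simp only [Fin.zero_eta, Fin.mk_one, zero_ne_one, if_false]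
      rw [e, norm_div, Complex.norm_ofNat]
      linarith
    · refine le_of_eq_of_le ?_ (norm_nonneg (ν k))
      rw [norm_eq_zero]
      simp
      field_simp
      ring

theorem thetaFamily_sub_stateBasis_of_ne (hω : GapCondition ω) {ν : ℕ → ℂ} {k l : ℕ}
    {t t' : Fin 2} (n j : Fin 2) (h : ¬(t = t' ∧ l = k)) {B : ℝ} (hB : 0 ≤ B) (hk1 : |(ν k).re| ≤ 1)
    (hv : ∀ j, ‖blockVec ω b hω ν ((k, t), j) (componentIndex (t', n)) l‖ ≤ |(ν k).re| * B / 2)  :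
    ‖(thetaFamily ω b hω ν (blockIndex ((k, t), j)) - stateBasis (blockIndex ((k, t), j)))
      (componentIndex (t', n)) l‖ ≤ B := by
  have hs : ∀ x y : StateSpace, (x - y) (componentIndex (t', n)) l
      = x (componentIndex (t', n)) l - y (componentIndex (t', n)) l := fun _ _ => rfl
  have ha : ∀ x y : StateSpace, (x + y) (componentIndex (t', n)) l
      = x (componentIndex (t', n)) l + y (componentIndex (t', n)) l := fun _ _ => rfl
  have hc : ∀ (c : ℂ) (x : StateSpace), (c • x) (componentIndex (t', n)) l
      = c * x (componentIndex (t', n)) l := fun _ _ => rfl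
  have he : stateBasis (blockIndex ((k, t), j)) (componentIndex (t', n)) l = 0 := by
    rw [stateBasis_apply, stateBasisVec_apply, blockIndex_apply, if_neg]
    rintro ⟨h1, h2⟩
    have := componentIndex.injective h1
    simp only [Prod.mk.injEq] at this
    exact h ⟨this.1.symm, h2⟩
  rw [hs, he, sub_zero]
  have hv0 := hv 0
  have hv1 := hv 1
  fin_cases j
  · change ‖thetaFamily ω b hω ν (blockIndex ((k, t), 0)) (componentIndex (t', n)) l‖ ≤ _
    rw [thetaFamily_blockIndex_zero, hc, hs, norm_mul, norm_inv, Complex.norm_real,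
      Real.norm_eq_abs]
    refine inv_mul_le_of_le_mul₀ (abs_nonneg _) hB ((norm_sub_le _ _).trans ?_)
    linarith
  · change ‖thetaFamily ω b hω ν (blockIndex ((k, t), 1)) (componentIndex (t', n)) l‖ ≤ _
    rw [thetaFamily_blockIndex_one, ha]
    refine (norm_add_le _ _).trans ((add_le_add hv0 hv1).trans ?_)
    nlinarith

/-- The last bound compensates the division by $b_k\,\mathrm{Re}\,\nu_k$; it follows from
$|\nu_k|\le\frac32\lambda_k^0$, $\mathrm{Re}\,\nu_k>\frac12\lambda_k^0$ and $\lambda_k^0\le|b_k|$,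
with $5$ rounding up $\frac92$. -/
theorem IsSpectralLabelling.eventually_bounds (hb : ∀ k, b k ≠ 0) (hω : GapCondition ω)
    {ν : ℕ → ℂ} (hν : IsSpectralLabelling ω b ν) {c : ℝ} (hc : 0 < c) :
    ∀ᶠ k in atTop, ‖ν k‖ ≤ c ∧ ‖ν k‖ ≤ 2 * |b k| ∧ ‖ν k‖ ^ 2 ≤ 5 * (|b k| * |(ν k).re|) := by
  filter_upwards [hν.asymptotics,
    (tendsto_lambdaZero hb hω).eventually_lt_const (by positivity : 0 < c / 2)] with k hk hkc
  have hlam := lambdaZero_pos hb hω k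
  have hle := lambdaZero_le (b := b) hω k
  have hre := re_pos_of_norm_sub_lt hk
  have hn : ‖ν k‖ ≤ 3 / 2 * lambdaZero ω b k := by
    have h := norm_add_le (ν k - lambdaZero ω b k) (lambdaZero ω b k : ℂ)
    rw [sub_add_cancel, Complex.norm_real, Real.norm_eq_abs, abs_of_pos hlam] at h
    linarith
  refine ⟨by linarith, by linarith, ?_⟩
  have h1 : lambdaZero ω b k * (lambdaZero ω b k / 2) ≤ |b k| * |(ν k).re| :=
    mul_le_mul hle (hre.le.trans (le_abs_self _)) (by positivity) (abs_nonneg _)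
  nlinarith [norm_nonneg (ν k)]

theorem gapWeight_nonneg (ω b : ℕ → ℝ) (k l : ℕ) : 0 ≤ gapWeight ω b k l := by
  unfold gapWeight
  split_ifs <;> positivity

theorem IsSpectralLabelling.summable_norm_sub_sq (hb : ∀ k, b k ≠ 0) (hω : GapCondition ω)
    (hbω : DoubleSumCondition ω b) {ν : ℕ → ℂ} (hν : IsSpectralLabelling ω b ν) :
    Summable fun i => ‖thetaFamily ω b hω ν (blockIndex i) - stateBasis (blockIndex i)‖ ^ 2 := by
  obtain ⟨c, C, hc, hC, hvec⟩ := exists_norm_blockVec_le (b := b) hω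
  have hrow := (summable_gapWeight_sq hbω).prod_factor
  refine summable_prod_of_finite (fun _ => by positivity) fun j =>
    summable_prod_of_finite (f := fun i => ‖thetaFamily ω b hω ν (blockIndex (i, j))
      - stateBasis (blockIndex (i, j))‖ ^ 2) (fun _ => by positivity) fun t => ?_
  -- In the constant, $5C$ serves the coordinates outside the block and $2$ those inside, where
  -- $|\nu_k|\le2|b_k|$.
  refine Summable.of_norm_bounded_eventually_nat
    ((summable_gapWeight_sq hbω).prod.mul_left (4 * (5 * C + 2) ^ 2)) ?_
  filter_upwards [hν.eventually_bounds hb hω hc, hν.eventually_bounds hb hω one_pos]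
    with k hk hk1
  obtain ⟨hkc, hkb, hkρ⟩ := hk
  rw [Real.norm_of_nonneg (by positivity)]
  refine norm_sq_le_of_coord_le (hrow k) fun m l => ?_
  obtain ⟨⟨t', n⟩, rfl⟩ := componentIndex.surjective m
  have hg := gapWeight_nonneg ω b k l
  by_cases h : t = t' ∧ l = k
  · obtain ⟨rfl, rfl⟩ := h
    refine (thetaFamily_sub_stateBasis_self hb hω (hν.re_ne_zero l) t j n).trans ?_
    rw [gapWeight, if_pos rfl] at hg ⊢
    nlinarith
  · refine (thetaFamily_sub_stateBasis_of_ne hω n j h (B := 5 * (C * gapWeight ω b k l))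
      (by positivity) ((Complex.abs_re_le_norm _).trans hk1.1) fun j => ?_).trans (by nlinarith)
    refine (hvec ν k t j t' n l hkc h).trans ?_
    have hbk : 0 < |b k| := abs_pos.2 (hb k)
    calc ‖ν k‖ ^ 2 / (2 * |b k|) * (C * gapWeight ω b k l)
        ≤ 5 * (|b k| * |(ν k).re|) / (2 * |b k|) * (C * gapWeight ω b k l) := by gcongr
      _ = |(ν k).re| * (5 * (C * gapWeight ω b k l)) / 2 := by field_simp

theorem summable_const_div_succ_sq (D : ℝ) : Summable fun k : ℕ => (D / ((k : ℝ) + 1)) ^ 2 := by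
  have h := (summable_nat_add_iff 1).2 (Real.summable_one_div_nat_pow.2 one_lt_two)
  refine (h.mul_left (D ^ 2)).congr fun k => ?_
  push_cast
  rw [div_pow]
  ring

theorem IsSpectralLabelling.eventually_resolvent_le (hb : ∀ k, b k ≠ 0) (hω : GapCondition ω)
    {ν : ℕ → ℂ} (hν : IsSpectralLabelling ω b ν) (s : ℂ) :
    ∃ D : ℝ, 0 < D ∧ ∀ t j, ∀ᶠ k : ℕ in atTop,
      ‖(blockSigma ω ν ((k, t), j) - s)⁻¹‖ ≤ D / ((k : ℝ) + 1) := by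
  obtain ⟨c, hc, hck, -⟩ := hω.exists_gap
  refine ⟨2 / c, by positivity, fun t j => ?_⟩
  filter_upwards [hν.eventually_bounds hb hω one_pos,
    hω.tendsto_atTop.eventually_ge_atTop (2 * (1 + ‖s‖))] with k hk hks
  have h1 : ‖blockPhase t * (ω k : ℂ)‖ = ω k := by
    rw [norm_mul, norm_blockPhase, one_mul, Complex.norm_real, Real.norm_eq_abs,
      abs_of_pos (hω.pos k)]
  have h2 : ω k / 2 ≤ ‖blockSigma ω ν ((k, t), j) - s‖ := by
    have h3 := norm_sub_norm_le (blockPhase t * (ω k : ℂ)) (blockShift ν ((k, t), j) - s)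
    have h4 := norm_sub_le (blockShift ν ((k, t), j)) s
    rw [norm_blockShift] at h4
    have h5 : blockPhase t * (ω k : ℂ) - (blockShift ν ((k, t), j) - s)
        = -(blockSigma ω ν ((k, t), j) - s) := by
      simp only [blockSigma]
      ring
    rw [h5, norm_neg, h1] at h3
    simp only at h4
    linarith [hk.1]
  have h6 := hck k
  rw [norm_inv, div_div, ← inv_div]
  refine inv_anti₀ (by positivity) (le_trans ?_ h2)
  linarith

theorem IsSpectralLabelling.isRieszBasis_thetaFamily (hb : ∀ k, b k ≠ 0) (hω : GapCondition ω)
    (hbω : DoubleSumCondition ω b) {ν : ℕ → ℂ} (hν : IsSpectralLabelling ω b ν) :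
    IsRieszBasis (thetaFamily ω b hω ν) := by
  obtain ⟨s, R, hR⟩ := exists_resolvent (b := b) hb hω
  obtain ⟨D, hD, hres⟩ := hν.eventually_resolvent_le hb hω s
  have hne : ∀ i, blockSigma ω ν i - s ≠ 0 := fun i =>
    sub_ne_zero.2 (hR _ (hν.isEigenvalueOf_blockSigma i)).1
  have hρ : ∀ i : ℕ × Fin 2, ((ν i.1).re : ℂ) ≠ 0 := fun i => by exact_mod_cast hν.re_ne_zero i.1
  have hν0 : ∀ k, ν k ≠ 0 := fun k h => hν.re_ne_zero k (by rw [h]; rfl)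
  have hsum : ∀ f : ℕ × Fin 2 → ℂ, (∀ t, ∀ᶠ k : ℕ in atTop,
      ‖f (k, t)‖ ≤ (D + D ^ 2) / ((k : ℝ) + 1)) → Summable fun i => ‖f i‖ ^ 2 := by
    intro f hf
    refine summable_prod_of_finite (fun _ => by positivity) fun t => ?_
    refine Summable.of_norm_bounded_eventually_nat (summable_const_div_succ_sq (D + D ^ 2)) ?_
    filter_upwards [hf t] with k hk
    rw [Real.norm_of_nonneg (by positivity)]
    gcongr
  -- The factor $2\,\mathrm{Re}\,\nu_k$ cancels the $\rho_k^{-1}$ in the critical entry of `D`,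
  -- leaving a product of two resolvent values.
  have hsub : ∀ i : ℕ × Fin 2, (blockSigma ω ν (i, 0) - s)⁻¹ - (blockSigma ω ν (i, 1) - s)⁻¹
      = -(2 * ((ν i.1).re : ℂ) * ((blockSigma ω ν (i, 0) - s)⁻¹
        * (blockSigma ω ν (i, 1) - s)⁻¹)) := by
    intro i
    rw [← blockSigma_sub ω ν i]
    have h0 := hne (i, 0)
    have h1 := hne (i, 1)
    field_simp
    ring
  refine IsRieszBasis.of_comp_equiv blockIndex ?_
  refine isRieszBasis_of_eigenvector_pairs (stateBasis.reindexEquiv blockIndex)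
    (w := blockVec ω b hω ν) (R := R) (r := fun i => (blockSigma ω ν i - s)⁻¹)
    (ρ := fun i => ((ν i.1).re : ℂ)) (fun i => ?_) (fun i => ?_) (fun i j hij => ?_) hρ
    (thetaFamily_blockIndex_zero hω ν) (thetaFamily_blockIndex_one hω ν) ?_
    (hsum _ fun t => ?_) (hsum _ fun t => ?_) (hsum _ fun t => ?_)
  · refine smul_ne_zero (div_ne_zero (mul_ne_zero (blockSign_ne_zero _) (pow_ne_zero 2 ?_)) ?_)
      (thetaVec_ne_zero hb hω ((hν.isEigenvalueOf_blockSigma i).ne_and_feedback hb hω).1)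
    · rw [← norm_pos_iff, norm_blockShift, norm_pos_iff]
      exact hν0 _
    · exact mul_ne_zero two_ne_zero (by exact_mod_cast hb _)
  · rw [blockVec, map_smul, (hR _ (hν.isEigenvalueOf_blockSigma i)).2, smul_comm]
  · exact hν.blockSigma_injective (sub_left_injective (inv_injective hij))
  · simpa using hν.summable_norm_sub_sq hb hω hbω
  · filter_upwards [hres t 0, hres t 1] with k h0 h1
    have h2 := norm_add_le (blockSigma ω ν ((k, t), 0) - s)⁻¹ (blockSigma ω ν ((k, t), 1) - s)⁻¹
    have h3 : D / ((k : ℝ) + 1) ≤ (D + D ^ 2) / ((k : ℝ) + 1) := by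
      gcongr
      linarith [sq_nonneg D]
    rw [norm_div, Complex.norm_ofNat]
    linarith
  · filter_upwards [hres t 0, hres t 1] with k h0 h1
    have h2 : ((blockSigma ω ν ((k, t), 0) - s)⁻¹ - (blockSigma ω ν ((k, t), 1) - s)⁻¹) / 2
        * ((ν k).re : ℂ)⁻¹ = -((blockSigma ω ν ((k, t), 0) - s)⁻¹
        * (blockSigma ω ν ((k, t), 1) - s)⁻¹) := by
      rw [hsub (k, t)]
      have := hρ (k, t)
      simp only at this
      field_simp
    have h3 : D / ((k : ℝ) + 1) ≤ D := div_le_self hD.le (by linarith [k.cast_nonneg (α := ℝ)])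
    simp only [h2, norm_neg, norm_mul]
    calc _ ≤ D / ((k : ℝ) + 1) * D := mul_le_mul h0 (h1.trans h3) (norm_nonneg _) (by positivity)
      _ = D ^ 2 / ((k : ℝ) + 1) := by ring
      _ ≤ (D + D ^ 2) / ((k : ℝ) + 1) := by gcongr; linarith
  · filter_upwards [hres t 0, hres t 1, hν.eventually_bounds hb hω one_pos] with k h0 h1 hk
    have h2 := norm_sub_le (blockSigma ω ν ((k, t), 0) - s)⁻¹ (blockSigma ω ν ((k, t), 1) - s)⁻¹
    have h3 : D / ((k : ℝ) + 1) ≤ (D + D ^ 2) / ((k : ℝ) + 1) := by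
      gcongr
      linarith [sq_nonneg D]
    have h4 : ‖((ν k).re : ℂ)‖ ≤ 1 := by
      rw [Complex.norm_real]
      exact (Complex.abs_re_le_norm _).trans hk.1
    rw [norm_mul, norm_div, Complex.norm_ofNat]
    refine (mul_le_of_le_one_right (by positivity) h4).trans ?_
    linarith

theorem mainTheorem3 (ω : ℕ → ℝ) (b : EllTwoReal) (hb : ∀ k, b k ≠ 0)
    (hω : GapCondition ω) (hbω : DoubleSumCondition ω b) :
    (∀ᶠ k in atTop, ∃! μ : ℂ,
      ‖μ - (lambdaZero ω b k : ℂ)‖ < lambdaZero ω b k / 2 ∧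
        IsEigenvalueOf (hamiltonianOp ω b) (Complex.I * ω k + μ)) ∧
    ∀ ν : ℕ → ℂ, IsSpectralLabelling ω b ν →
      (∀ i, IsEigenvectorOf (hamiltonianOp ω b) (sigmaFamily ω ν i)
        (thetaVec ω b hω (sigmaFamily ω ν i))) ∧
      IsRieszBasis (thetaFamily ω b hω ν) := by
  refine ⟨eventually_existsUnique_eigenvalue hb hω hbω, fun ν hν => ⟨fun i => ?_,
    hν.isRieszBasis_thetaFamily hb hω hbω⟩⟩
  obtain ⟨h1, h2⟩ := (hν.isEigenvalue i).ne_and_feedback hb hω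
  exact isEigenvectorOf_thetaVec hb hω h1 h2

end MainTheorem
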